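/- **Setting.** A Feynman graph $\Gamma$ of the Ben Geloun–Rivasseau (BGR) model is a finite stranded graph. Each vertex carries equally many fields $\varphi$ and $\bar\varphi$; each field has four strands of colours $1,\dots,4$; the vertex pairs the strands of each colour of its fields $\varphi$ with those of the same colour of its fields $\bar\varphi$. Internal edges (propagators) join a field $\bar\varphi$ to a field $\varphi$ colour by colour; unjoined fields are the external edges. Up to permutation of the colours, every vertex is one of the interaction vertices $V_{6;1},V_{6;2},V_{4;1},V_{4;2}$ or one of the counter-term vertices $V_{4;1}^*$ (strands of $V_{4;1}$) and $V_{2;1},V_{2;2},V_{2;3}$ (two fields, all strands joined). The counter-term degree of a vertex is $1$ for $V_{4;1}^*$, is $2,1,0$ for $V_{2;1},V_{2;2},V_{2;3}$, and is $0$ for the interaction vertices. A graph is 1PI if it has at least one internal and more than one external edge, is connected, and stays connected when any one internal edge is removed. Let $\omega$ be an isomorphism-invariant integer-valued function on graphs (the superficial divergence degree). The residue $\mathrm{Res}(\gamma)$ of a connected graph $\gamma$ is the single vertex whose fields are the external edges of $\gamma$, whose strands are those obtained by following the strands of $\gamma$ from one external edge to another, and whose counter-term degree is $\omega(\gamma)$.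 Let $\mathcal G_{sd}^\omega$ be the set of superficially divergent graphs: the 1PI Feynman graphs $\gamma$ with $\omega(\gamma)\ge 0$ whose residue is a vertex of the model. A subgraph of $\Gamma$ is given by a set of internal edges of $\Gamma$ together with their end vertices and all fields at these vertices. For $\gamma\subset\Gamma$, the graph $\Gamma/\gamma$ is obtained by replacing every connected component of $\gamma$ by its residue. If $\mathrm{Res}(\gamma')$ is of the type of the vertex $v$ of $\gamma$ (same strands for some identification of the fields at $v$ with the external edges of $\gamma'$, and same counter-term degree), $\gamma'\circ_v\gamma$ denotes any graph obtained from $\gamma$ by replacing $v$ with $\gamma'$ along such an identification. Let $\mathcal H$ be the commutative unital $\mathbb C$-algebra freely generated by the isomorphism classes of 1PI Feynman graphs; products are disjoint unions and $\mathbf 1$ is the empty graph. Let $\Delta:\mathcal H\to\mathcal H\otimes\mathcal H$ be the algebra homomorphism given on 1PI graphs by $$\Delta(\Gamma)=\Gamma\otimes\mathbf 1+\mathbf 1\otimes\Gamma+\sum_{\gamma}\gamma\otimes\Gamma/\gamma ,$$ where $\gamma$ runs over the subgraphs of $\Gamma$ with a nonempty proper subset of the internal edges of $\Gamma$ all of whose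 connected components belong to $\mathcal G_{sd}^\omega$. **Lemma.** Assume that $\mathcal G_{sd}^\omega$ is closed under subgraph contraction and insertion: 1. if $\gamma\in\mathcal G_{sd}^\omega$ and $\gamma'\subsetneq\gamma$ is a subgraph with $\gamma'\in\mathcal G_{sd}^\omega$, then $\gamma/\gamma'\in\mathcal G_{sd}^\omega$, and $\gamma/\gamma'$ has the same residue as $\gamma$, that is, $\omega(\gamma/\gamma')=\omega(\gamma)$; 2. if $\gamma,\gamma'\in\mathcal G_{sd}^\omega$ and $v$ is a vertex of $\gamma$ of the type of $\mathrm{Res}(\gamma')$, then every insertion $\gamma'\circ_v\gamma$ belongs to $\mathcal G_{sd}^\omega$. Then $\Delta$ is well defined (the formula depends only on the isomorphism class of $\Gamma$) and coassociative: $(\Delta\otimes\mathrm{id})\circ\Delta=(\mathrm{id}\otimes\Delta)\circ\Delta$. -/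

import Mathlib

open scoped TensorProduct

noncomputable section

/-- A stranded (tensor) graph. The fields `φ` at the vertices are the elements of `A`, the
conjugate fields `φ̄` the elements of `B`; `vA` and `vB` say at which vertex they sit. Every field
has four strands, one for each colour `c : Fin 4`, and `strand c a b` says that the vertex
identifies the strand of colour `c` of the field `a` with that of the field `b`. An internal
propagator `e : E` joins the conjugate field `src e` to the field `tgt e` without permuting
strands. The fields that are not joined by a propagator are the external edges. The number `deg v`
is the degree of divergence of the counter-term attached to `v` (zero for a bare vertex). -/
structure StrandedGraph where
  V : Type
  A : Type
  B : Type
  E : Type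
  finV : Finite V
  finA : Finite A
  finB : Finite B
  finE : Finite E
  vA : A → V
  vB : B → V
  strand : Fin 4 → A → B → Prop
  strand_local : ∀ c a b, strand c a b → vA a = vB b
  src : E → B
  tgt : E → A
  src_inj : Function.Injective src
  tgt_inj : Function.Injective tgt
  deg : V → ℤ

/-- The vertex types of the Ben Geloun-Rivasseau model: the interaction vertices `V_{6;1}`,
`V_{6;2}`, `V_{4;1}`, `V_{4;2}` and the counter-term vertices `V_{4;1}^*`, `V_{2;1}`, `V_{2;2}`,
`V_{2;3}`. -/
inductive VertexType where
  | V61 | V62 | V41 | V42 | V41star | V21 | V22 | V23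

namespace VertexType

/-- The number of fields `φ` at the vertex, which is also the number of fields `φ̄`. -/
def size : VertexType → ℕ
  | V61 => 3
  | V62 => 3
  | V41 => 2
  | V42 => 2
  | V41star => 2
  | V21 => 1
  | V22 => 1
  | V23 => 1

/-- The degree of divergence of the counter-term: linear for `V_{4;1}^*`; quadratic, linear,
logarithmic for `V_{2;1}`, `V_{2;2}`, `V_{2;3}`; zero for the interaction vertices. -/
def degree : VertexType → ℤ
  | V61 => 0
  | V62 => 0
  | V41 => 0
  | V42 => 0
  | V41star => 1
  | V21 => 2
  | V22 => 1
  | V23 => 0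

/-- The strands of the vertex: the strand of colour `c` of the `i`-th field `φ` is identified with
that of the `pairing c i`-th field `φ̄`. The momenta of the fields `φ` are `p, k, m` in this
order, those of the fields `φ̄` are `q, l, n`. -/
def pairing : (t : VertexType) → Fin 4 → Fin t.size → Fin t.size
  | V61 => (![![2, 0, 1], ![0, 1, 2], ![0, 1, 2], ![0, 1, 2]] : Fin 4 → Fin 3 → Fin 3)
  | V62 => (![![2, 0, 1], ![1, 0, 2], ![1, 0, 2], ![0, 1, 2]] : Fin 4 → Fin 3 → Fin 3)
  | V41 => (![![1, 0], ![0, 1], ![0, 1], ![0, 1]] : Fin 4 → Fin 2 → Fin 2)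
  | V42 => fun _ i => i
  | V41star => (![![1, 0], ![0, 1], ![0, 1], ![0, 1]] : Fin 4 → Fin 2 → Fin 2)
  | V21 => fun _ i => i
  | V22 => fun _ i => i
  | V23 => fun _ i => i

end VertexType

/-- The fields `LA`, `LB`, with strands `str` and counter-term degree `d`, form a vertex of the
model, up to a permutation `σ` of the four colours. -/
def IsModelVertex {A B : Type} (LA : Set A) (LB : Set B) (str : Fin 4 → A → B → Prop) (d : ℤ) :
    Prop :=
  ∃ (t : VertexType) (σ : Equiv.Perm (Fin 4)) (p : Fin t.size → A) (q : Fin t.size → B),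
    t.degree = d ∧ Function.Injective p ∧ Function.Injective q ∧
      Set.range p = LA ∧ Set.range q = LB ∧
      ∀ c i j, str c (p i) (q j) ↔ t.pairing (σ c) i = j

namespace StrandedGraph

/-- Isomorphism of stranded graphs. -/
structure Iso (Γ Γ' : StrandedGraph) where
  fV : Γ.V ≃ Γ'.V
  fA : Γ.A ≃ Γ'.A
  fB : Γ.B ≃ Γ'.B
  fE : Γ.E ≃ Γ'.E
  vA_comm : ∀ a, Γ'.vA (fA a) = fV (Γ.vA a)
  vB_comm : ∀ b, Γ'.vB (fB b) = fV (Γ.vB b)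
  strand_iff : ∀ c a b, Γ'.strand c (fA a) (fB b) ↔ Γ.strand c a b
  src_comm : ∀ e, Γ'.src (fE e) = fB (Γ.src e)
  tgt_comm : ∀ e, Γ'.tgt (fE e) = fA (Γ.tgt e)
  deg_comm : ∀ v, Γ'.deg (fV v) = Γ.deg v

def Iso.refl (Γ : StrandedGraph) : Iso Γ Γ where
  fV := Equiv.refl _
  fA := Equiv.refl _
  fB := Equiv.refl _
  fE := Equiv.refl _
  vA_comm _ := rfl
  vB_comm _ := rfl
  strand_iff _ _ _ := Iff.rfl
  src_comm _ := rfl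
  tgt_comm _ := rfl
  deg_comm _ := rfl

def Iso.symm {Γ Γ' : StrandedGraph} (f : Iso Γ Γ') : Iso Γ' Γ where
  fV := f.fV.symm
  fA := f.fA.symm
  fB := f.fB.symm
  fE := f.fE.symm
  vA_comm a := by rw [Equiv.eq_symm_apply, ← f.vA_comm, Equiv.apply_symm_apply]
  vB_comm b := by rw [Equiv.eq_symm_apply, ← f.vB_comm, Equiv.apply_symm_apply]
  strand_iff c a b := by rw [← f.strand_iff, Equiv.apply_symm_apply, Equiv.apply_symm_apply]
  src_comm e := by rw [Equiv.eq_symm_apply, ← f.src_comm, Equiv.apply_symm_apply]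
  tgt_comm e := by rw [Equiv.eq_symm_apply, ← f.tgt_comm, Equiv.apply_symm_apply]
  deg_comm v := by rw [← f.deg_comm, Equiv.apply_symm_apply]

def Iso.trans {Γ Γ' Γ'' : StrandedGraph} (f : Iso Γ Γ') (g : Iso Γ' Γ'') : Iso Γ Γ'' where
  fV := f.fV.trans g.fV
  fA := f.fA.trans g.fA
  fB := f.fB.trans g.fB
  fE := f.fE.trans g.fE
  vA_comm a := by simp [g.vA_comm, f.vA_comm]
  vB_comm b := by simp [g.vB_comm, f.vB_comm]
  strand_iff c a b := by simp [g.strand_iff, f.strand_iff]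
  src_comm e := by simp [g.src_comm, f.src_comm]
  tgt_comm e := by simp [g.tgt_comm, f.tgt_comm]
  deg_comm v := by simp [g.deg_comm, f.deg_comm]

variable (Γ : StrandedGraph)

/-- `Γ` is a Feynman graph of the model: all its vertices are vertices of the model. -/
def IsFeynman : Prop :=
  ∀ v, IsModelVertex {a | Γ.vA a = v} {b | Γ.vB b = v} Γ.strand (Γ.deg v)

/-- The external edges that are fields `φ`. -/
def extA : Set Γ.A := {a | ∀ e, Γ.tgt e ≠ a}

/-- The external edges that are fields `φ̄`. -/
def extB : Set Γ.B := {b | ∀ e, Γ.src e ≠ b}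

/-- Two vertices are equivalent if they are connected by propagators in `S`. -/
def conn (S : Set Γ.E) : Setoid Γ.V :=
  Relation.EqvGen.setoid (fun v w => ∃ e ∈ S, Γ.vB (Γ.src e) = v ∧ Γ.vA (Γ.tgt e) = w)

/-- One-particle-irreducible graphs: there is an internal edge and more than one external edge, the
graph is connected, and it stays connected when any one internal edge is removed. -/
def IsOnePI : Prop :=
  Nonempty Γ.E ∧ 1 < Γ.extA.ncard + Γ.extB.ncard ∧
    (∀ v w, (Γ.conn Set.univ) v w) ∧ ∀ e v w, (Γ.conn {e}ᶜ) v w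

/-- The vertex `v` is an end of a propagator in `S`. -/
def Touches (S : Set Γ.E) (v : Γ.V) : Prop :=
  ∃ e ∈ S, Γ.vB (Γ.src e) = v ∨ Γ.vA (Γ.tgt e) = v

/-- The subgraph with internal edges `S`: its vertices are the ends of the edges in `S`, and all
other fields at these vertices are external edges. -/
def sub (S : Set Γ.E) : StrandedGraph where
  V := {v // Γ.Touches S v}
  A := {a // Γ.Touches S (Γ.vA a)}
  B := {b // Γ.Touches S (Γ.vB b)}
  E := {e // e ∈ S}
  finV := have := Γ.finV; inferInstance
  finA := have := Γ.finA; inferInstance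
  finB := have := Γ.finB; inferInstance
  finE := have := Γ.finE; inferInstance
  vA a := ⟨Γ.vA a, a.2⟩
  vB b := ⟨Γ.vB b, b.2⟩
  strand c a b := Γ.strand c a b
  strand_local c a b h := Subtype.ext (Γ.strand_local c a b h)
  src e := ⟨Γ.src e, e.1, e.2, Or.inl rfl⟩
  tgt e := ⟨Γ.tgt e, e.1, e.2, Or.inr rfl⟩
  src_inj _ _ h := Subtype.ext (Γ.src_inj (congrArg Subtype.val h))
  tgt_inj _ _ h := Subtype.ext (Γ.tgt_inj (congrArg Subtype.val h))
  deg v := Γ.deg v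

/-- `Γ.Trace S c a b`: the strand of colour `c` that starts at the field `a` can be followed,
alternately through vertices and propagators in `S`, to the field `b`. -/
inductive Trace (S : Set Γ.E) (c : Fin 4) : Γ.A → Γ.B → Prop
  | vertex {a : Γ.A} {b : Γ.B} : Γ.strand c a b → Trace S c a b
  | propagator {a : Γ.A} {e : Γ.E} {b : Γ.B} :
      e ∈ S → Γ.strand c a (Γ.src e) → Trace S c (Γ.tgt e) b → Trace S c a b

variable {Γ} in
theorem Trace.mk_eq {S : Set Γ.E} {c : Fin 4} {a : Γ.A} {b : Γ.B} (h : Γ.Trace S c a b) :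
    Quotient.mk (Γ.conn S) (Γ.vA a) = Quotient.mk (Γ.conn S) (Γ.vB b) := by
  induction h with
  | vertex h => rw [Γ.strand_local _ _ _ h]
  | propagator he h _ ih =>
    rw [Γ.strand_local _ _ _ h, ← ih]
    exact Quotient.sound (Relation.EqvGen.rel _ _ ⟨_, he, rfl, rfl⟩)

/-- The internal edges of the connected component `x` of the subgraph with internal edges `S`. -/
def comp (S : Set Γ.E) (x : Quotient (Γ.conn S)) : Set Γ.E :=
  {e | e ∈ S ∧ Quotient.mk (Γ.conn S) (Γ.vA (Γ.tgt e)) = x}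

open Classical in
/-- The contraction `Γ/γ`, where `γ` is the subgraph with internal edges `S`: each connected
component of `γ` is shrunk to one vertex, the propagators of `γ` and the strands that are closed
inside `γ` are removed, and the other strands are composed. The new vertex carries the degree of
divergence `ω` of the component; vertices that are not in `γ` are unchanged. -/
def contract (ω : StrandedGraph → ℤ) (S : Set Γ.E) : StrandedGraph where
  V := Quotient (Γ.conn S)
  A := {a // ∀ e ∈ S, Γ.tgt e ≠ a}
  B := {b // ∀ e ∈ S, Γ.src e ≠ b}
  E := {e // e ∉ S}
  finV := have := Γ.finV; inferInstance
  finA := have := Γ.finA; inferInstance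
  finB := have := Γ.finB; inferInstance
  finE := have := Γ.finE; inferInstance
  vA a := Quotient.mk _ (Γ.vA a)
  vB b := Quotient.mk _ (Γ.vB b)
  strand c a b := Γ.Trace S c a b
  strand_local _ _ _ h := Trace.mk_eq h
  src e := ⟨Γ.src e, fun _ he' h => e.2 (Γ.src_inj h ▸ he')⟩
  tgt e := ⟨Γ.tgt e, fun _ he' h => e.2 (Γ.tgt_inj h ▸ he')⟩
  src_inj _ _ h := Subtype.ext (Γ.src_inj (congrArg Subtype.val h))
  tgt_inj _ _ h := Subtype.ext (Γ.tgt_inj (congrArg Subtype.val h))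
  deg x := if (Γ.comp S x).Nonempty then ω (Γ.sub (Γ.comp S x)) else Γ.deg x.out

/-- The residue of the connected graph `Γ`, with counter-term degree `ω Γ`, is a vertex of the
model. The fields of the residue are the external edges of `Γ`, its strands are those of `Γ` that
join external edges. -/
def ResidueInModel (ω : StrandedGraph → ℤ) : Prop :=
  IsModelVertex Γ.extA Γ.extB (Γ.Trace Set.univ) (ω Γ)

/-- The superficially divergent graphs: 1PI Feynman graphs with `ω Γ ≥ 0` (and with a residue in
the model, so that they can be contracted). -/
def IsSD (ω : StrandedGraph → ℤ) : Prop :=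
  Γ.IsFeynman ∧ Γ.IsOnePI ∧ 0 ≤ ω Γ ∧ Γ.ResidueInModel ω

/-- The data for inserting `γ` into the vertex `v` of `Γ`: the fields at `v` are identified with the
external edges of `γ` such that the strands at `v` are those of the residue of `γ`. -/
structure Gluing (γ Γ : StrandedGraph) (v : Γ.V) where
  α : {a // Γ.vA a = v} ≃ {a // a ∈ γ.extA}
  β : {b // Γ.vB b = v} ≃ {b // b ∈ γ.extB}
  strand_iff : ∀ c a b, Γ.strand c a.1 b.1 ↔ γ.Trace Set.univ c (α a).1 (β b).1

open Classical in
/-- The insertion of `γ` into the vertex `v` of `Γ` with gluing data `g`. -/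
def insertAt (γ Γ : StrandedGraph) (v : Γ.V) (g : Gluing γ Γ v) : StrandedGraph where
  V := γ.V ⊕ {w // w ≠ v}
  A := γ.A ⊕ {a // Γ.vA a ≠ v}
  B := γ.B ⊕ {b // Γ.vB b ≠ v}
  E := γ.E ⊕ Γ.E
  finV := have := Γ.finV; have := γ.finV; inferInstance
  finA := have := Γ.finA; have := γ.finA; inferInstance
  finB := have := Γ.finB; have := γ.finB; inferInstance
  finE := have := Γ.finE; have := γ.finE; inferInstance
  vA := Sum.map γ.vA (fun a => ⟨Γ.vA a.1, a.2⟩)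
  vB := Sum.map γ.vB (fun b => ⟨Γ.vB b.1, b.2⟩)
  strand c x y :=
    match x, y with
    | Sum.inl a, Sum.inl b => γ.strand c a b
    | Sum.inr a, Sum.inr b => Γ.strand c a.1 b.1
    | _, _ => False
  strand_local c x y h := by
    rcases x with a | a <;> rcases y with b | b
    · exact congrArg Sum.inl (γ.strand_local c a b h)
    · exact h.elim
    · exact h.elim
    · exact congrArg Sum.inr (Subtype.ext (Γ.strand_local c a.1 b.1 h))
  src := Sum.elim (fun e => Sum.inl (γ.src e)) (fun e =>
    if h : Γ.vB (Γ.src e) = v then Sum.inl (g.β ⟨Γ.src e, h⟩).1 else Sum.inr ⟨Γ.src e, h⟩)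
  tgt := Sum.elim (fun e => Sum.inl (γ.tgt e)) (fun e =>
    if h : Γ.vA (Γ.tgt e) = v then Sum.inl (g.α ⟨Γ.tgt e, h⟩).1 else Sum.inr ⟨Γ.tgt e, h⟩)
  src_inj := by
    have key : ∀ (e : γ.E) (e' : Γ.E), Sum.inl (γ.src e) ≠
        (if h : Γ.vB (Γ.src e') = v then (Sum.inl (g.β ⟨Γ.src e', h⟩).1 : γ.B ⊕ {b // Γ.vB b ≠ v})
          else Sum.inr ⟨Γ.src e', h⟩) := by
      intro e e' h
      split_ifs at h with h'
      exact (g.β ⟨Γ.src e', h'⟩).2 e (Sum.inl.inj h)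
    rintro (e | e) (e' | e') h
    · exact congrArg Sum.inl (γ.src_inj (Sum.inl.inj h))
    · exact (key e e' h).elim
    · exact (key e' e h.symm).elim
    · refine congrArg Sum.inr (Γ.src_inj ?_)
      simp only [Sum.elim_inr] at h
      split_ifs at h with h1 h2 h2
      · exact congrArg Subtype.val (g.β.injective (Subtype.ext (Sum.inl.inj h)))
      · exact congrArg Subtype.val (Sum.inr.inj h)
  tgt_inj := by
    have key : ∀ (e : γ.E) (e' : Γ.E), Sum.inl (γ.tgt e) ≠
        (if h : Γ.vA (Γ.tgt e') = v then (Sum.inl (g.α ⟨Γ.tgt e', h⟩).1 : γ.A ⊕ {a // Γ.vA a ≠ v})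
          else Sum.inr ⟨Γ.tgt e', h⟩) := by
      intro e e' h
      split_ifs at h with h'
      exact (g.α ⟨Γ.tgt e', h'⟩).2 e (Sum.inl.inj h)
    rintro (e | e) (e' | e') h
    · exact congrArg Sum.inl (γ.tgt_inj (Sum.inl.inj h))
    · exact (key e e' h).elim
    · exact (key e' e h.symm).elim
    · refine congrArg Sum.inr (Γ.tgt_inj ?_)
      simp only [Sum.elim_inr] at h
      split_ifs at h with h1 h2 h2
      · exact congrArg Subtype.val (g.α.injective (Subtype.ext (Sum.inl.inj h)))
      · exact congrArg Subtype.val (Sum.inr.inj h)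
  deg := Sum.elim γ.deg (fun w => Γ.deg w.1)

/-- The set of superficially divergent graphs is closed under contraction: if `γ` and a proper
subgraph `γ'` of it are superficially divergent, then so is `γ/γ'`, and `γ/γ'` has the same residue
as `γ`. (The strands of the residue are always the same; the last condition is that the
counter-term is the same, too.) -/
def ClosedUnderContraction (ω : StrandedGraph → ℤ) : Prop :=
  ∀ (γ : StrandedGraph) (S : Set γ.E), γ.IsSD ω → S ≠ Set.univ → (γ.sub S).IsSD ω →
    (γ.contract ω S).IsSD ω ∧ ω (γ.contract ω S) = ω γ

/-- The set of superficially divergent graphs is closed under insertion: if `γ` and `γ'` are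
superficially divergent, and the residue of `γ'` is of the type of the vertex `v` of `γ`, then every
insertion of `γ'` into `v` is superficially divergent. -/
def ClosedUnderInsertion (ω : StrandedGraph → ℤ) : Prop :=
  ∀ (γ' γ : StrandedGraph) (v : γ.V) (g : Gluing γ' γ v), γ'.IsSD ω → γ.IsSD ω →
    γ.deg v = ω γ' → (insertAt γ' γ v g).IsSD ω

/-- The subgraph with internal edges `S` is a nonempty proper subgraph, and its connected
components are superficially divergent. -/
def IsDivergentUnion (ω : StrandedGraph → ℤ) (S : Set Γ.E) : Prop :=
  S.Nonempty ∧ S ≠ Set.univ ∧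
    ∀ x, (Γ.comp S x).Nonempty → (Γ.sub (Γ.comp S x)).IsSD ω

variable {Γ}

theorem conn_contract {ω : StrandedGraph → ℤ} {S : Set Γ.E} {T : Set Γ.E}
    {T' : Set (Γ.contract ω S).E} (hT : ∀ e (he : e ∉ S), e ∈ T → ⟨e, he⟩ ∈ T') {v w : Γ.V}
    (h : (Γ.conn T) v w) :
    ((Γ.contract ω S).conn T') (Quotient.mk (Γ.conn S) v) (Quotient.mk (Γ.conn S) w) := by
  induction h with
  | rel v w h =>
    obtain ⟨e, heT, rfl, rfl⟩ := h
    by_cases he : e ∈ S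
    · have : Quotient.mk (Γ.conn S) (Γ.vB (Γ.src e)) = Quotient.mk (Γ.conn S) (Γ.vA (Γ.tgt e)) :=
        Quotient.sound (Relation.EqvGen.rel _ _ ⟨e, he, rfl, rfl⟩)
      rw [this]
      exact Relation.EqvGen.refl _
    · exact Relation.EqvGen.rel _ _ ⟨⟨e, he⟩, hT e he heT, rfl, rfl⟩
  | refl v => exact Relation.EqvGen.refl _
  | symm _ _ _ ih => exact Relation.EqvGen.symm _ _ ih
  | trans _ _ _ _ _ ih1 ih2 => exact Relation.EqvGen.trans _ _ _ ih1 ih2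

theorem IsOnePI.contract {ω : StrandedGraph → ℤ} {S : Set Γ.E} (h : Γ.IsOnePI)
    (hS : S ≠ Set.univ) : (Γ.contract ω S).IsOnePI := by
  obtain ⟨-, hext, hc, hb⟩ := h
  refine ⟨?_, ?_, ?_, ?_⟩
  · obtain ⟨e, he⟩ := (Set.ne_univ_iff_exists_notMem S).1 hS
    exact ⟨⟨e, he⟩⟩
  · have h1 : Subtype.val '' (Γ.contract ω S).extA = Γ.extA := by
      ext a
      constructor
      · rintro ⟨a, ha, rfl⟩ e he
        by_cases heS : e ∈ S
        · exact a.2 e heS he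
        · exact ha ⟨e, heS⟩ (Subtype.ext he)
      · intro ha
        exact ⟨⟨a, fun e _ => ha e⟩, fun e he => ha e.1 (congrArg Subtype.val he), rfl⟩
    have h2 : Subtype.val '' (Γ.contract ω S).extB = Γ.extB := by
      ext a
      constructor
      · rintro ⟨a, ha, rfl⟩ e he
        by_cases heS : e ∈ S
        · exact a.2 e heS he
        · exact ha ⟨e, heS⟩ (Subtype.ext he)
      · intro ha
        exact ⟨⟨a, fun e _ => ha e⟩, fun e he => ha e.1 (congrArg Subtype.val he), rfl⟩
    rw [← h1, ← h2] at hext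
    erw [Set.ncard_image_of_injective _ Subtype.val_injective,
      Set.ncard_image_of_injective _ Subtype.val_injective] at hext
    exact hext
  · intro v w
    induction v using Quotient.ind
    induction w using Quotient.ind
    exact conn_contract (fun _ _ _ => Set.mem_univ _) (hc _ _)
  · intro e v w
    induction v using Quotient.ind
    induction w using Quotient.ind
    refine conn_contract (T := {e.1}ᶜ) (T' := {e}ᶜ) ?_ (hb e.1 _ _)
    intro e' he hne h
    have h1 := congrArg Subtype.val (Set.mem_singleton_iff.1 h)
    exact hne h1

theorem eq_of_conn_of_comp_empty {S : Set Γ.E} {v w : Γ.V} (h : (Γ.conn S) v w)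
    (hv : ¬ (Γ.comp S (Quotient.mk _ v)).Nonempty) : v = w := by
  induction h with
  | rel v w h =>
    obtain ⟨e, he, h1, h2⟩ := h
    subst h1 h2
    exact (hv ⟨e, he, Quotient.sound
      (Relation.EqvGen.symm _ _ (Relation.EqvGen.rel _ _ ⟨e, he, rfl, rfl⟩))⟩).elim
  | refl => rfl
  | symm v w h ih =>
    have : Quotient.mk (Γ.conn S) v = Quotient.mk _ w := Quotient.sound h
    exact (ih (this ▸ hv)).symm
  | trans u v w h1 h2 ih1 ih2 =>
    have := ih1 hv
    subst this
    exact ih2 hv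

theorem comp_touches {S : Set Γ.E} {e : Γ.E} (he : e ∈ S) :
    e ∈ Γ.comp S (Quotient.mk _ (Γ.vB (Γ.src e))) :=
  ⟨he, Quotient.sound
    (Relation.EqvGen.symm _ _ (Relation.EqvGen.rel _ _ ⟨e, he, rfl, rfl⟩))⟩

theorem touches_comp_iff {S : Set Γ.E} {x : Quotient (Γ.conn S)} (hx : (Γ.comp S x).Nonempty)
    {v : Γ.V} : Γ.Touches (Γ.comp S x) v ↔ Quotient.mk (Γ.conn S) v = x := by
  constructor
  · rintro ⟨e, ⟨he, rfl⟩, rfl | rfl⟩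
    · exact Quotient.sound (Relation.EqvGen.rel _ _ ⟨e, he, rfl, rfl⟩)
    · rfl
  · rintro rfl
    have key : ∀ {v w : Γ.V}, (Γ.conn S) v w → v ≠ w → Γ.Touches S v ∧ Γ.Touches S w := by
      intro v w h
      induction h with
      | rel v w h =>
        obtain ⟨e, he, h1, h2⟩ := h
        exact fun _ => ⟨⟨e, he, Or.inl h1⟩, ⟨e, he, Or.inr h2⟩⟩
      | refl => exact fun h => (h rfl).elim
      | symm _ _ _ ih => exact fun h => (ih h.symm).symm
      | trans u v w h1 h2 ih1 ih2 =>
        intro h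
        by_cases huv : u = v
        · subst huv; exact ih2 h
        · by_cases hvw : v = w
          · subst hvw; exact ih1 h
          · exact ⟨(ih1 huv).1, (ih2 hvw).2⟩
    have ht : Γ.Touches S v := by
      obtain ⟨e, he, hev⟩ := hx
      by_cases h : Γ.vA (Γ.tgt e) = v
      · exact ⟨e, he, Or.inr h⟩
      · exact (key (Quotient.exact hev) h).2
    obtain ⟨e, he, rfl | rfl⟩ := ht
    · exact ⟨e, comp_touches he, Or.inl rfl⟩
    · exact ⟨e, ⟨he, rfl⟩, Or.inr rfl⟩

theorem trace_sub_iff {S : Set Γ.E} {x : Quotient (Γ.conn S)} {c : Fin 4}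
    (a : (Γ.sub (Γ.comp S x)).A) (b : (Γ.sub (Γ.comp S x)).B) :
    (Γ.sub (Γ.comp S x)).Trace Set.univ c a b ↔ Γ.Trace S c a.1 b.1 := by
  constructor
  · intro h
    induction h with
    | vertex h => exact Trace.vertex h
    | @propagator a e b _ h _ ih => exact Trace.propagator (e := e.1) e.2.1 h ih
  · obtain ⟨a, ha⟩ := a
    obtain ⟨b, hb⟩ := b
    intro h
    change Γ.Trace S c a b at h
    induction h with
    | vertex h => exact Trace.vertex h
    | @propagator a e b he h _ ih =>
      have hx : (Γ.comp S x).Nonempty := ha.imp fun _ h => h.1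
      have hmem : e ∈ Γ.comp S x := by
        have := (touches_comp_iff hx).1 ha
        rw [Γ.strand_local _ _ _ h] at this
        rw [← this]
        exact comp_touches he
      exact @Trace.propagator (Γ.sub (Γ.comp S x)) Set.univ c ⟨a, ha⟩ ⟨e, hmem⟩ ⟨b, hb⟩
        (Set.mem_univ _) h (ih ⟨e, hmem, Or.inr rfl⟩ hb)

theorem trace_of_comp_empty {S : Set Γ.E} {c : Fin 4} {a : Γ.A} {b : Γ.B}
    (ha : ¬ (Γ.comp S (Quotient.mk _ (Γ.vA a))).Nonempty) :
    Γ.Trace S c a b ↔ Γ.strand c a b := by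
  constructor
  · intro h
    cases h with
    | vertex h => exact h
    | @propagator _ e _ he h _ =>
      rw [Γ.strand_local _ _ _ h] at ha
      exact (ha ⟨e, comp_touches he⟩).elim
  · exact Trace.vertex

theorem IsFeynman.contract {ω : StrandedGraph → ℤ} {S : Set Γ.E} (h : Γ.IsFeynman)
    (hS : Γ.IsDivergentUnion ω S) : (Γ.contract ω S).IsFeynman := by
  intro x
  by_cases hx : (Γ.comp S x).Nonempty
  · obtain ⟨t, σ, p, q, ht, hp, hq, hpr, hqr, hpq⟩ := (hS.2.2 x hx).2.2.2
    have hpe : ∀ i, ∀ e ∈ S, Γ.tgt e ≠ (p i).1 := by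
      intro i e he heq
      have h1 : p i ∈ (Γ.sub (Γ.comp S x)).extA := hpr ▸ Set.mem_range_self i
      have h2 : e ∈ Γ.comp S x := ⟨he, by rw [heq]; exact (touches_comp_iff hx).1 (p i).2⟩
      exact h1 ⟨e, h2⟩ (Subtype.ext heq)
    have hqe : ∀ i, ∀ e ∈ S, Γ.src e ≠ (q i).1 := by
      intro i e he heq
      have h1 : q i ∈ (Γ.sub (Γ.comp S x)).extB := hqr ▸ Set.mem_range_self i
      have h2 : e ∈ Γ.comp S x := by
        rw [← (touches_comp_iff hx).1 (q i).2, ← heq]; exact comp_touches he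
      exact h1 ⟨e, h2⟩ (Subtype.ext heq)
    refine ⟨t, σ, fun i => ⟨(p i).1, hpe i⟩, fun i => ⟨(q i).1, hqe i⟩, ?_, ?_, ?_, ?_, ?_, ?_⟩
    · rw [ht]; exact (if_pos hx).symm
    · intro i j hij
      have h1 := congrArg Subtype.val hij
      exact hp (Subtype.ext h1)
    · intro i j hij
      have h1 := congrArg Subtype.val hij
      exact hq (Subtype.ext h1)
    · ext a
      constructor
      · rintro ⟨i, rfl⟩
        exact (touches_comp_iff hx).1 (p i).2
      · intro ha
        have h1 : (⟨a.1, (touches_comp_iff hx).2 ha⟩ : (Γ.sub (Γ.comp S x)).A) ∈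
            (Γ.sub (Γ.comp S x)).extA := fun e he => a.2 e.1 e.2.1 (congrArg Subtype.val he)
        rw [← hpr] at h1
        obtain ⟨i, hi⟩ := h1
        have h2 := congrArg Subtype.val hi
        exact ⟨i, Subtype.ext h2⟩
    · ext a
      constructor
      · rintro ⟨i, rfl⟩
        exact (touches_comp_iff hx).1 (q i).2
      · intro ha
        have h1 : (⟨a.1, (touches_comp_iff hx).2 ha⟩ : (Γ.sub (Γ.comp S x)).B) ∈
            (Γ.sub (Γ.comp S x)).extB := fun e he => a.2 e.1 e.2.1 (congrArg Subtype.val he)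
        rw [← hqr] at h1
        obtain ⟨i, hi⟩ := h1
        have h2 := congrArg Subtype.val hi
        exact ⟨i, Subtype.ext h2⟩
    · intro c i j
      exact (trace_sub_iff (p i) (q j)).symm.trans (hpq c i j)
  · obtain ⟨v, rfl⟩ := Quotient.exists_rep x
    have hout : (Quotient.mk (Γ.conn S) v).out = v :=
      (eq_of_conn_of_comp_empty (Quotient.exact (Quotient.out_eq _).symm) hx).symm
    obtain ⟨t, σ, p, q, ht, hp, hq, hpr, hqr, hpq⟩ := h v
    have hpv : ∀ i, Γ.vA (p i) = v := fun i => by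
      have : p i ∈ Set.range p := ⟨i, rfl⟩
      rw [hpr] at this; exact this
    have hqv : ∀ i, Γ.vB (q i) = v := fun i => by
      have : q i ∈ Set.range q := ⟨i, rfl⟩
      rw [hqr] at this; exact this
    have hpe : ∀ i, ∀ e ∈ S, Γ.tgt e ≠ p i := fun i e he heq =>
      hx ⟨e, he, by rw [heq, hpv]⟩
    have hqe : ∀ i, ∀ e ∈ S, Γ.src e ≠ q i := fun i e he heq =>
      hx ⟨e, by rw [← hqv i, ← heq]; exact comp_touches he⟩
    refine ⟨t, σ, fun i => ⟨p i, hpe i⟩, fun i => ⟨q i, hqe i⟩, ?_, ?_, ?_, ?_, ?_, ?_⟩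
    · rw [ht]
      exact (congrArg Γ.deg hout).symm.trans (if_neg hx).symm
    · exact fun i j hij => hp (congrArg Subtype.val hij)
    · exact fun i j hij => hq (congrArg Subtype.val hij)
    · ext a
      constructor
      · rintro ⟨i, rfl⟩
        exact congrArg (Quotient.mk (Γ.conn S)) (hpv i)
      · intro ha
        have h1 : Γ.vA a.1 = v :=
          (eq_of_conn_of_comp_empty (Quotient.exact (Eq.symm ha)) hx).symm
        have h2 : a.1 ∈ Set.range p := by rw [hpr]; exact h1
        obtain ⟨i, hi⟩ := h2
        exact ⟨i, Subtype.ext hi⟩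
    · ext a
      constructor
      · rintro ⟨i, rfl⟩
        exact congrArg (Quotient.mk (Γ.conn S)) (hqv i)
      · intro ha
        have h1 : Γ.vB a.1 = v :=
          (eq_of_conn_of_comp_empty (Quotient.exact (Eq.symm ha)) hx).symm
        have h2 : a.1 ∈ Set.range q := by rw [hqr]; exact h1
        obtain ⟨i, hi⟩ := h2
        exact ⟨i, Subtype.ext hi⟩
    · intro c i j
      rw [← hpq c i j]
      exact trace_of_comp_empty (by rw [hpv]; exact hx)

end StrandedGraph

open StrandedGraph

/-- The 1PI Feynman graphs of the model. -/
abbrev OnePIGraph : Type 1 := {Γ : StrandedGraph // Γ.IsFeynman ∧ Γ.IsOnePI}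

/-- Isomorphism of 1PI Feynman graphs. -/
instance onePISetoid : Setoid OnePIGraph where
  r Γ Γ' := Nonempty (Iso Γ.1 Γ'.1)
  iseqv := ⟨fun Γ => ⟨Iso.refl Γ.1⟩, fun ⟨f⟩ => ⟨f.symm⟩, fun ⟨f⟩ ⟨g⟩ => ⟨f.trans g⟩⟩

/-- The algebra `ℋ`: the commutative `ℂ`-algebra freely generated by the isomorphism classes of 1PI
Feynman graphs. Monomials are disjoint unions of 1PI graphs, and `1` is the empty graph. -/
abbrev GraphAlgebra : Type 1 := MvPolynomial (Quotient onePISetoid) ℂ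

/-- A 1PI Feynman graph as an element of `ℋ`. -/
def gen (Γ : OnePIGraph) : GraphAlgebra := MvPolynomial.X (Quotient.mk onePISetoid Γ)

/-- The subgraph of `Γ` with internal edges `S`, as an element of `ℋ`: the product of its connected
components. -/
def unionGen {ω : StrandedGraph → ℤ} {Γ : StrandedGraph} {S : Set Γ.E}
    (hS : Γ.IsDivergentUnion ω S) : GraphAlgebra :=
  ∏ᶠ x : {x : Quotient (Γ.conn S) // (Γ.comp S x).Nonempty},
    gen ⟨Γ.sub (Γ.comp S x.1), (hS.2.2 x.1 x.2).1, (hS.2.2 x.1 x.2).2.1⟩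

/-- The right-hand side `Γ ⊗ 1 + 1 ⊗ Γ + ∑ γ ⊗ Γ/γ` of the definition of the coproduct. -/
def coproductGen (ω : StrandedGraph → ℤ) (Γ : OnePIGraph) : GraphAlgebra ⊗[ℂ] GraphAlgebra :=
  gen Γ ⊗ₜ[ℂ] 1 + 1 ⊗ₜ[ℂ] gen Γ +
    ∑ᶠ S : {S : Set Γ.1.E // Γ.1.IsDivergentUnion ω S},
      unionGen S.2 ⊗ₜ[ℂ]
        gen ⟨Γ.1.contract ω S.1, Γ.2.1.contract S.2, Γ.2.2.contract S.2.2.1⟩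

/-- The coproduct: the algebra homomorphism that is given by `coproductGen` on the generators. It
is defined by means of representatives of the isomorphism classes. -/
def coproduct (ω : StrandedGraph → ℤ) : GraphAlgebra →ₐ[ℂ] GraphAlgebra ⊗[ℂ] GraphAlgebra :=
  MvPolynomial.aeval (fun x => coproductGen ω x.out)

end

open scoped TensorProduct

noncomputable section

namespace StrandedGraph

/-! For a 1PI graph `Γ`, both sides of coassociativity are the sum of `T ⊗ S/T ⊗ Γ/S` over the same
nested pairs `T ⊆ S` of edge sets, and they differ only in which of the two is chosen first.

To make this literal, the coproduct is written as a single sum over `divSets`: the edge sets all of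
whose components are superficially divergent, together with the set of all edges, whether or not `Γ`
itself is divergent. A graph without edges counts as `1`, so the empty set yields `1 ⊗ Γ` and the
full set yields `Γ ⊗ 1` (`coproductGen_eq`). Isomorphisms transport edge sets, components, residues
and contractions, so the sum depends only on the isomorphism class.

On the left, a divergent subset `T` of a divergent `S` amounts to an independent choice of a
divergent subset in each component of `S`; multiplying out the coproducts of the components gives
the sum over `T ⊆ S` (`Divergent.coproduct_subGen`). No closure hypothesis is needed here.

On the right, the edge sets of `Γ/T` are those of `Γ` that contain `T`, and divergence must match
under this correspondence (`Divergent.divergent_edgesMod_iff`). Closure under contraction gives that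
`S/T` is divergent if `S` is; closure under insertion gives the converse, because `Γ` is recovered
by inserting a contracted component back into its residue. Preservation of `ω` makes the
counter-term degrees of `(Γ/T)/(S/T)` and `Γ/S` agree. The hypotheses contract or insert one
connected graph at a time, and an induction over the components of `T` extends them to disconnected
`T` (`Divergent.isSD_contract`). -/

instance (Γ : StrandedGraph) : Finite Γ.V := Γ.finV
instance (Γ : StrandedGraph) : Finite Γ.A := Γ.finA
instance (Γ : StrandedGraph) : Finite Γ.B := Γ.finB
instance (Γ : StrandedGraph) : Finite Γ.E := Γ.finE

/-! ### Connected components as sets of edges -/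

section Components

variable {Γ : StrandedGraph} {S T X C : Set Γ.E} {v w : Γ.V} {e : Γ.E}

theorem conn_edge (he : e ∈ S) : (Γ.conn S) (Γ.vB (Γ.src e)) (Γ.vA (Γ.tgt e)) :=
  Relation.EqvGen.rel _ _ ⟨e, he, rfl, rfl⟩

/-- `Γ.conn S` is the smallest equivalence relation that relates the ends of the edges in `S`. -/
theorem conn_le {r : Setoid Γ.V} (h : ∀ e ∈ S, r (Γ.vB (Γ.src e)) (Γ.vA (Γ.tgt e)))
    (hvw : (Γ.conn S) v w) : r v w := by
  induction hvw with
  | rel v w h' =>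
    obtain ⟨e, he, rfl, rfl⟩ := h'
    exact h e he
  | refl v => exact r.refl' v
  | symm _ _ _ ih => exact r.symm' ih
  | trans _ _ _ _ _ ih1 ih2 => exact r.trans' ih1 ih2

theorem conn_mono (h : S ⊆ T) (hvw : (Γ.conn S) v w) : (Γ.conn T) v w :=
  conn_le (fun _ he => conn_edge (h he)) hvw

theorem touches_src (he : e ∈ S) : Γ.Touches S (Γ.vB (Γ.src e)) := ⟨e, he, Or.inl rfl⟩

theorem touches_tgt (he : e ∈ S) : Γ.Touches S (Γ.vA (Γ.tgt e)) := ⟨e, he, Or.inr rfl⟩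

theorem Touches.mono (h : S ⊆ T) (hv : Γ.Touches S v) : Γ.Touches T v := by
  obtain ⟨e, he, h'⟩ := hv
  exact ⟨e, h he, h'⟩

variable (Γ) in
/-- The edges in `S` that have an end in common with an edge in `X` belong to `X`. -/
def ClosedIn (S X : Set Γ.E) : Prop :=
  ∀ e ∈ S, Γ.Touches X (Γ.vB (Γ.src e)) ∨ Γ.Touches X (Γ.vA (Γ.tgt e)) → e ∈ X

theorem ClosedIn.mono (h : Γ.ClosedIn S X) (hT : T ⊆ S) : Γ.ClosedIn T X :=
  fun e he h' => h e (hT he) h'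

/-- A path in `S` that starts at an end of an edge in the closed set `X` can never leave `X`. The
two claims are proved together because concatenating paths in the second one needs the first at the
middle vertex. -/
theorem ClosedIn.touches_and_conn (h : Γ.ClosedIn S X) (hvw : (Γ.conn S) v w) :
    (Γ.Touches X v ↔ Γ.Touches X w) ∧ (Γ.Touches X v → (Γ.conn (S ∩ X)) v w) := by
  induction hvw with
  | rel v w h' =>
    obtain ⟨e, he, rfl, rfl⟩ := h'
    refine ⟨⟨fun h1 => touches_tgt (h e he (Or.inl h1)),
      fun h1 => touches_src (h e he (Or.inr h1))⟩, fun h1 => conn_edge ⟨he, h e he (Or.inl h1)⟩⟩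
  | refl v => exact ⟨Iff.rfl, fun _ => (Γ.conn _).refl' v⟩
  | symm _ _ _ ih => exact ⟨ih.1.symm, fun h1 => (Γ.conn _).symm' (ih.2 (ih.1.2 h1))⟩
  | trans _ _ _ _ _ ih1 ih2 =>
    exact ⟨ih1.1.trans ih2.1, fun h1 => (Γ.conn _).trans' (ih1.2 h1) (ih2.2 (ih1.1.1 h1))⟩

variable (Γ) in
/-- `C` is the set of edges of a connected component of the subgraph with internal edges `S`. -/
structure IsComp (S C : Set Γ.E) : Prop where
  nonempty : C.Nonempty
  subset : C ⊆ S
  closed : Γ.ClosedIn S C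
  connected : ∀ v w, Γ.Touches C v → Γ.Touches C w → (Γ.conn C) v w

theorem mem_comp_iff {x : Quotient (Γ.conn S)} :
    e ∈ Γ.comp S x ↔ e ∈ S ∧ Quotient.mk (Γ.conn S) (Γ.vA (Γ.tgt e)) = x := Iff.rfl

theorem closedIn_comp (x : Quotient (Γ.conn S)) : Γ.ClosedIn S (Γ.comp S x) := by
  rintro e he (h | h) <;> rw [touches_comp_iff (h.imp fun _ h => h.1)] at h
  · exact h ▸ comp_touches he
  · exact ⟨he, h⟩

theorem isComp_comp {x : Quotient (Γ.conn S)} (hx : (Γ.comp S x).Nonempty) :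
    Γ.IsComp S (Γ.comp S x) where
  nonempty := hx
  subset _ he := he.1
  closed := closedIn_comp x
  connected v w hv hw := by
    have h : (Γ.conn S) v w := Quotient.exact
      (((touches_comp_iff hx).1 hv).trans ((touches_comp_iff hx).1 hw).symm)
    exact conn_mono Set.inter_subset_right (((closedIn_comp x).touches_and_conn h).2 hv)

/-- With `isComp_comp`, this replaces classes in `Quotient (Γ.conn S)`, whose type varies with `S`,
by edge sets of `Γ`, which can be compared for different `S`. -/
theorem IsComp.eq_comp (h : Γ.IsComp S C) (hv : Γ.Touches C v) :
    C = Γ.comp S (Quotient.mk _ v) := by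
  ext e
  constructor
  · exact fun he => ⟨h.subset he, Quotient.sound
      (conn_mono h.subset (h.connected _ _ (touches_tgt he) hv))⟩
  · rintro ⟨he, h'⟩
    exact h.closed e he (Or.inr ((h.closed.touches_and_conn (Quotient.exact h')).1.2 hv))

theorem IsComp.eq_of_mem (h : Γ.IsComp S C) (h' : Γ.IsComp S X) (he : e ∈ C) (he' : e ∈ X) :
    C = X :=
  (h.eq_comp (touches_tgt he)).trans (h'.eq_comp (touches_tgt he')).symm

theorem exists_isComp (he : e ∈ S) : ∃ C, Γ.IsComp S C ∧ e ∈ C :=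
  ⟨Γ.comp S (Quotient.mk _ (Γ.vA (Γ.tgt e))), isComp_comp ⟨e, he, rfl⟩, he, rfl⟩

/-- The components of `T ∩ X` are the components of `T` inside `X`, if `X` is closed. -/
theorem isComp_inter_iff (hX : Γ.ClosedIn T X) :
    Γ.IsComp (T ∩ X) C ↔ Γ.IsComp T C ∧ C ⊆ X := by
  constructor
  · intro h
    refine ⟨⟨h.nonempty, h.subset.trans Set.inter_subset_left, fun e he h' => ?_, h.connected⟩,
      h.subset.trans Set.inter_subset_right⟩
    have hCX := h.subset.trans Set.inter_subset_right
    exact h.closed e ⟨he, hX e he (h'.imp (Touches.mono hCX) (Touches.mono hCX))⟩ h'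
  · rintro ⟨h, hCX⟩
    exact ⟨h.nonempty, Set.subset_inter h.subset hCX,
      h.closed.mono Set.inter_subset_left, h.connected⟩

/-- A component of `T ⊆ S` that meets a component of `S` is contained in it. -/
theorem IsComp.subset_of_mem (hC : Γ.IsComp T C) (hX : Γ.IsComp S X) (hTS : T ⊆ S)
    (he : e ∈ C) (he' : e ∈ X) : C ⊆ X := by
  intro e' h'
  refine hX.closed e' (hTS (hC.subset h')) (Or.inr ?_)
  exact (hX.closed.touches_and_conn (conn_mono (hC.subset.trans hTS)
    (hC.connected _ _ (touches_tgt he) (touches_tgt h')))).1.1 (touches_tgt he')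

theorem IsComp.of_subset (hX : Γ.IsComp S X) (hTS : T ⊆ S) (hXT : X ⊆ T) : Γ.IsComp T X :=
  ⟨hX.nonempty, hXT, hX.closed.mono hTS, hX.connected⟩

theorem IsComp.self_isComp (hX : Γ.IsComp S X) : Γ.IsComp X X :=
  hX.of_subset hX.subset subset_rfl

/-- Removing a component does not change the other components. -/
theorem IsComp.isComp_diff_iff (hX : Γ.IsComp S X) :
    Γ.IsComp (S \ X) C ↔ Γ.IsComp S C ∧ C ≠ X := by
  constructor
  · intro h
    refine ⟨⟨h.nonempty, h.subset.trans Set.sdiff_subset, fun e he h' => ?_, h.connected⟩, ?_⟩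
    · by_contra heC
      have heX : e ∈ X := by
        by_contra heX
        exact heC (h.closed e ⟨he, heX⟩ h')
      -- `C` and the removed component `X` share no vertex, since an edge of `C` at such a vertex
      -- would have to lie in `X`.
      have key : ∀ v, Γ.Touches X v → Γ.Touches C v → False := by
        rintro v hv ⟨e', he', h1 | h1⟩
        · exact (h.subset he').2 (hX.closed e' (h.subset he').1 (Or.inl (h1 ▸ hv)))
        · exact (h.subset he').2 (hX.closed e' (h.subset he').1 (Or.inr (h1 ▸ hv)))
      rcases h' with h' | h'
      · exact key _ (touches_src heX) h'
      · exact key _ (touches_tgt heX) h'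
    · rintro rfl
      obtain ⟨e, he⟩ := h.nonempty
      exact (h.subset he).2 he
  · rintro ⟨h, hne⟩
    exact ⟨h.nonempty, fun e he => ⟨h.subset he, fun he' => hne (h.eq_of_mem hX he he')⟩,
      h.closed.mono Set.sdiff_subset, h.connected⟩

variable (Γ) in
/-- The set of connected components of the subgraph with internal edges `S`. -/
def comps (S : Set Γ.E) : Finset (Set Γ.E) := (Set.toFinite {C | Γ.IsComp S C}).toFinset

@[simp] theorem mem_comps : C ∈ Γ.comps S ↔ Γ.IsComp S C := by simp [comps]

variable (Γ) in
/-- All connected components of the subgraph with internal edges `S` are superficially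
divergent. -/
def Divergent (ω : StrandedGraph → ℤ) (S : Set Γ.E) : Prop :=
  ∀ C, Γ.IsComp S C → (Γ.sub C).IsSD ω

theorem divergent_iff {ω : StrandedGraph → ℤ} :
    Γ.Divergent ω S ↔ ∀ x, (Γ.comp S x).Nonempty → (Γ.sub (Γ.comp S x)).IsSD ω := by
  constructor
  · exact fun h x hx => h _ (isComp_comp hx)
  · intro h C hC
    obtain ⟨e, he⟩ := hC.nonempty
    have := hC.eq_comp (touches_tgt he)
    rw [this]
    exact h _ (this ▸ hC.nonempty)

theorem Divergent.inter {ω : StrandedGraph → ℤ} (h : Γ.Divergent ω T) (hX : Γ.ClosedIn T X) :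
    Γ.Divergent ω (T ∩ X) :=
  fun C hC => h C ((isComp_inter_iff hX).1 hC).1

theorem divergent_empty {ω : StrandedGraph → ℤ} : Γ.Divergent ω ∅ :=
  fun _ h => (h.subset h.nonempty.some_mem).elim

open Classical in
-- The representative `x.out` in the definition of `contract` is harmless: it is used only for
-- classes that no edge of `S` meets, and these are singletons.
theorem contract_deg_mk (ω : StrandedGraph → ℤ) (S : Set Γ.E) (v : Γ.V) :
    (Γ.contract ω S).deg (Quotient.mk (Γ.conn S) v) =
      if (Γ.comp S (Quotient.mk _ v)).Nonempty then ω (Γ.sub (Γ.comp S (Quotient.mk _ v)))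
      else Γ.deg v := by
  by_cases h : (Γ.comp S (Quotient.mk _ v)).Nonempty
  · rw [if_pos h]
    exact if_pos h
  · rw [if_neg h]
    refine (if_neg h).trans (congrArg Γ.deg ?_)
    exact (eq_of_conn_of_comp_empty (Quotient.exact (Quotient.out_eq _).symm) h).symm

end Components

end StrandedGraph

/-! ### Invariance under isomorphism -/

theorem IsModelVertex.map {A B A' B' : Type} {LA : Set A} {LB : Set B} {LA' : Set A'}
    {LB' : Set B'} {str : Fin 4 → A → B → Prop} {str' : Fin 4 → A' → B' → Prop} {d d' : ℤ}
    (h : IsModelVertex LA LB str d) (fA : A → A') (fB : B → B') (hA : Function.Injective fA)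
    (hB : Function.Injective fB) (hLA : fA '' LA = LA') (hLB : fB '' LB = LB')
    (hstr : ∀ c a b, str' c (fA a) (fB b) ↔ str c a b) (hd : d = d') :
    IsModelVertex LA' LB' str' d' := by
  obtain ⟨t, σ, p, q, ht, hp, hq, hpr, hqr, hpq⟩ := h
  refine ⟨t, σ, fA ∘ p, fB ∘ q, ht.trans hd, hA.comp hp, hB.comp hq, ?_, ?_, ?_⟩
  · rw [Set.range_comp, hpr, hLA]
  · rw [Set.range_comp, hqr, hLB]
  · intro c i j
    rw [← hpq]
    exact hstr _ _ _

namespace StrandedGraph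

variable {Γ Γ' : StrandedGraph}

def Iso.ofBijective (fV : Γ.V → Γ'.V) (fA : Γ.A → Γ'.A) (fB : Γ.B → Γ'.B) (fE : Γ.E → Γ'.E)
    (hV : Function.Bijective fV) (hA : Function.Bijective fA) (hB : Function.Bijective fB)
    (hE : Function.Bijective fE) (vA_comm : ∀ a, Γ'.vA (fA a) = fV (Γ.vA a))
    (vB_comm : ∀ b, Γ'.vB (fB b) = fV (Γ.vB b))
    (strand_iff : ∀ c a b, Γ'.strand c (fA a) (fB b) ↔ Γ.strand c a b)
    (src_comm : ∀ e, Γ'.src (fE e) = fB (Γ.src e)) (tgt_comm : ∀ e, Γ'.tgt (fE e) = fA (Γ.tgt e))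
    (deg_comm : ∀ v, Γ'.deg (fV v) = Γ.deg v) : Iso Γ Γ' where
  fV := Equiv.ofBijective fV hV
  fA := Equiv.ofBijective fA hA
  fB := Equiv.ofBijective fB hB
  fE := Equiv.ofBijective fE hE
  vA_comm := vA_comm
  vB_comm := vB_comm
  strand_iff := strand_iff
  src_comm := src_comm
  tgt_comm := tgt_comm
  deg_comm := deg_comm

namespace Iso

variable (f : Iso Γ Γ') {S C : Set Γ.E} {v w : Γ.V}

theorem touches_map (h : Γ.Touches S v) : Γ'.Touches (f.fE '' S) (f.fV v) := by
  obtain ⟨e, he, h⟩ := h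
  refine ⟨f.fE e, ⟨e, he, rfl⟩, ?_⟩
  rw [f.src_comm, f.tgt_comm, f.vA_comm, f.vB_comm, f.fV.apply_eq_iff_eq, f.fV.apply_eq_iff_eq]
  exact h

/-- With this, the converse of each transport statement is the forward direction applied to
`f.symm`. -/
theorem symm_image : f.symm.fE '' (f.fE '' S) = S := f.fE.symm_image_image S

theorem touches_iff : Γ'.Touches (f.fE '' S) (f.fV v) ↔ Γ.Touches S v := by
  refine ⟨fun h => ?_, f.touches_map⟩
  have h1 := f.symm.touches_map h
  rw [f.symm_image] at h1
  simpa [Iso.symm] using h1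

theorem conn_map (h : (Γ.conn S) v w) : (Γ'.conn (f.fE '' S)) (f.fV v) (f.fV w) := by
  refine conn_le (r := (Γ'.conn (f.fE '' S)).comap f.fV) (fun e he => ?_) h
  have h1 : (Γ'.conn (f.fE '' S)) _ _ := conn_edge ⟨e, he, rfl⟩
  rwa [f.src_comm, f.tgt_comm, f.vA_comm, f.vB_comm] at h1

theorem conn_iff : (Γ'.conn (f.fE '' S)) (f.fV v) (f.fV w) ↔ (Γ.conn S) v w := by
  refine ⟨fun h => ?_, f.conn_map⟩
  have h1 := f.symm.conn_map h
  rw [f.symm_image] at h1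
  simpa [Iso.symm] using h1

theorem trace_map {c : Fin 4} {a : Γ.A} {b : Γ.B} (h : Γ.Trace S c a b) :
    Γ'.Trace (f.fE '' S) c (f.fA a) (f.fB b) := by
  induction h with
  | vertex h => exact Trace.vertex ((f.strand_iff _ _ _).2 h)
  | @propagator a e b he h _ ih =>
    refine Trace.propagator (e := f.fE e) ⟨e, he, rfl⟩ ?_ ?_
    · rw [f.src_comm, f.strand_iff]
      exact h
    · rw [f.tgt_comm]
      exact ih

theorem trace_iff {c : Fin 4} {a : Γ.A} {b : Γ.B} :
    Γ'.Trace (f.fE '' S) c (f.fA a) (f.fB b) ↔ Γ.Trace S c a b := by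
  refine ⟨fun h => ?_, f.trace_map⟩
  have h1 := f.symm.trace_map h
  rw [f.symm_image] at h1
  simpa [Iso.symm] using h1

theorem isComp_map (h : Γ.IsComp S C) : Γ'.IsComp (f.fE '' S) (f.fE '' C) where
  nonempty := h.nonempty.image _
  subset := Set.image_mono h.subset
  closed := by
    rintro _ ⟨e, he, rfl⟩ h'
    rw [f.src_comm, f.tgt_comm, f.vA_comm, f.vB_comm, f.touches_iff, f.touches_iff] at h'
    exact ⟨e, h.closed e he h', rfl⟩
  connected := by
    intro v w hv hw
    obtain ⟨v, rfl⟩ := f.fV.surjective v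
    obtain ⟨w, rfl⟩ := f.fV.surjective w
    rw [f.touches_iff] at hv hw
    exact f.conn_map (h.connected v w hv hw)

theorem isComp_iff : Γ'.IsComp (f.fE '' S) (f.fE '' C) ↔ Γ.IsComp S C := by
  refine ⟨fun h => ?_, f.isComp_map⟩
  have h1 := f.symm.isComp_map h
  rwa [f.symm_image, f.symm_image] at h1

theorem extA_image : f.fA '' Γ.extA = Γ'.extA := by
  ext a
  obtain ⟨a, rfl⟩ := f.fA.surjective a
  rw [f.fA.injective.mem_set_image]
  constructor
  · intro h e he
    obtain ⟨e, rfl⟩ := f.fE.surjective e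
    rw [f.tgt_comm, f.fA.apply_eq_iff_eq] at he
    exact h e he
  · intro h e he
    exact h (f.fE e) (by rw [f.tgt_comm, he])

theorem extB_image : f.fB '' Γ.extB = Γ'.extB := by
  ext a
  obtain ⟨a, rfl⟩ := f.fB.surjective a
  rw [f.fB.injective.mem_set_image]
  constructor
  · intro h e he
    obtain ⟨e, rfl⟩ := f.fE.surjective e
    rw [f.src_comm, f.fB.apply_eq_iff_eq] at he
    exact h e he
  · intro h e he
    exact h (f.fE e) (by rw [f.src_comm, he])

theorem isFeynman (f : Iso Γ Γ') (h : Γ.IsFeynman) : Γ'.IsFeynman := by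
  intro v
  obtain ⟨v, rfl⟩ := f.fV.surjective v
  refine (h v).map f.fA f.fB f.fA.injective f.fB.injective ?_ ?_ f.strand_iff (f.deg_comm v).symm
  · ext a
    obtain ⟨a, rfl⟩ := f.fA.surjective a
    simp [f.vA_comm]
  · ext a
    obtain ⟨a, rfl⟩ := f.fB.surjective a
    simp [f.vB_comm]

theorem isOnePI (f : Iso Γ Γ') (h : Γ.IsOnePI) : Γ'.IsOnePI := by
  obtain ⟨⟨e⟩, hext, hc, hb⟩ := h
  refine ⟨⟨f.fE e⟩, ?_, fun v w => ?_, fun e v w => ?_⟩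
  · rwa [← f.extA_image, ← f.extB_image, Set.ncard_image_of_injective _ f.fA.injective,
      Set.ncard_image_of_injective _ f.fB.injective]
  · obtain ⟨v, rfl⟩ := f.fV.surjective v
    obtain ⟨w, rfl⟩ := f.fV.surjective w
    exact conn_mono (Set.subset_univ _) (f.conn_map (hc v w))
  · obtain ⟨v, rfl⟩ := f.fV.surjective v
    obtain ⟨w, rfl⟩ := f.fV.surjective w
    obtain ⟨e, rfl⟩ := f.fE.surjective e
    refine conn_mono ?_ (f.conn_map (hb e v w))
    rintro _ ⟨e', he', rfl⟩ h
    exact he' (f.fE.injective h)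

theorem residueInModel (f : Iso Γ Γ') {ω : StrandedGraph → ℤ} (hω : ω Γ = ω Γ')
    (h : Γ.ResidueInModel ω) :
    Γ'.ResidueInModel ω := by
  refine IsModelVertex.map h f.fA f.fB f.fA.injective f.fB.injective f.extA_image f.extB_image
    (fun c a b => ?_) hω
  rw [← f.trace_iff, Set.image_univ, f.fE.range_eq_univ]

theorem isSD (f : Iso Γ Γ') {ω : StrandedGraph → ℤ}
    (hω : ∀ Γ Γ' : StrandedGraph, Nonempty (StrandedGraph.Iso Γ Γ') → ω Γ = ω Γ')
    (h : Γ.IsSD ω) : Γ'.IsSD ω :=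
  ⟨f.isFeynman h.1, f.isOnePI h.2.1, hω Γ Γ' ⟨f⟩ ▸ h.2.2.1,
    f.residueInModel (hω Γ Γ' ⟨f⟩) h.2.2.2⟩

variable (S) in
/-- An isomorphism restricts to subgraphs. -/
def sub : Iso (Γ.sub S) (Γ'.sub (f.fE '' S)) where
  fV := f.fV.subtypeEquiv fun _ => f.touches_iff.symm
  fA := f.fA.subtypeEquiv fun a => by rw [f.vA_comm, f.touches_iff]
  fB := f.fB.subtypeEquiv fun a => by rw [f.vB_comm, f.touches_iff]
  fE := f.fE.subtypeEquiv fun a => (f.fE.injective.mem_set_image).symm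
  vA_comm a := Subtype.ext (f.vA_comm a.1)
  vB_comm b := Subtype.ext (f.vB_comm b.1)
  strand_iff c a b := f.strand_iff c a.1 b.1
  src_comm e := Subtype.ext (f.src_comm e.1)
  tgt_comm e := Subtype.ext (f.tgt_comm e.1)
  deg_comm v := f.deg_comm v.1

theorem comp_image (v : Γ.V) :
    f.fE '' (Γ.comp S (Quotient.mk _ v)) = Γ'.comp (f.fE '' S) (Quotient.mk _ (f.fV v)) := by
  ext e
  obtain ⟨e, rfl⟩ := f.fE.surjective e
  rw [f.fE.injective.mem_set_image, mem_comp_iff, mem_comp_iff, f.fE.injective.mem_set_image,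
    Quotient.eq, Quotient.eq, f.tgt_comm, f.vA_comm, f.conn_iff]

variable (S) in
/-- An isomorphism descends to contractions. -/
theorem contract {ω : StrandedGraph → ℤ}
    (hω : ∀ Γ Γ' : StrandedGraph, Nonempty (StrandedGraph.Iso Γ Γ') → ω Γ = ω Γ') :
    Nonempty (Iso (Γ.contract ω S) (Γ'.contract ω (f.fE '' S))) := by
  refine ⟨{
    fV := Quotient.congr f.fV fun v w => f.conn_iff.symm
    fA := f.fA.subtypeEquiv fun a => by
      simp only [Set.forall_mem_image, f.tgt_comm, ne_eq, EmbeddingLike.apply_eq_iff_eq]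
    fB := f.fB.subtypeEquiv fun a => by
      simp only [Set.forall_mem_image, f.src_comm, ne_eq, EmbeddingLike.apply_eq_iff_eq]
    fE := f.fE.subtypeEquiv fun a => not_congr (f.fE.injective.mem_set_image).symm
    vA_comm := fun a => congrArg (Quotient.mk _) (f.vA_comm a.1)
    vB_comm := fun b => congrArg (Quotient.mk _) (f.vB_comm b.1)
    strand_iff := fun c a b => f.trace_iff
    src_comm := fun e => Subtype.ext (f.src_comm e.1)
    tgt_comm := fun e => Subtype.ext (f.tgt_comm e.1)
    deg_comm := ?_ }⟩
  intro x
  induction x using Quotient.ind with | _ v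
  refine (contract_deg_mk ω (f.fE '' S) (f.fV v)).trans ((contract_deg_mk ω S v).trans ?_).symm
  rw [← f.comp_image, Set.image_nonempty, f.deg_comm]
  rw [hω _ _ ⟨f.sub _⟩]

end Iso

/-- Equal sets of edges give isomorphic subgraphs. -/
def isoSubOfEq {S T : Set Γ.E} (h : S = T) : Iso (Γ.sub S) (Γ.sub T) := h ▸ Iso.refl _

/-- Equal sets of edges give isomorphic contractions. -/
def isoContractOfEq (ω : StrandedGraph → ℤ) {S T : Set Γ.E} (h : S = T) :
    Iso (Γ.contract ω S) (Γ.contract ω T) := h ▸ Iso.refl _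

end StrandedGraph

/-! ### Subgraphs of subgraphs -/

theorem val_val_injective {α : Type*} {p : α → Prop} {q : Subtype p → Prop} :
    Function.Injective fun x : Subtype q => x.1.1 :=
  Subtype.val_injective.comp Subtype.val_injective

namespace StrandedGraph

variable {Γ : StrandedGraph} {X S T C : Set Γ.E}

section Sub

/-- The edges of the subgraph `Γ.sub X` that belong to `T`. -/
def edgesIn (X T : Set Γ.E) : Set (Γ.sub X).E := {e | e.1 ∈ T}

theorem mem_edgesIn {e : (Γ.sub X).E} : e ∈ edgesIn X T ↔ e.1 ∈ T := Iff.rfl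

theorem exists_edgesIn (T' : Set (Γ.sub X).E) : ∃ T ⊆ X, T' = edgesIn X T := by
  refine ⟨Subtype.val '' T', ?_, ?_⟩
  · rintro _ ⟨e, _, rfl⟩
    exact e.2
  · ext e
    exact (Subtype.val_injective.mem_set_image).symm

theorem edgesIn_eq_iff : edgesIn X S = edgesIn X T ↔ S ∩ X = T ∩ X := by
  constructor
  · intro h
    ext e
    exact and_congr_left fun he => Set.ext_iff.1 h ⟨e, he⟩
  · intro h
    ext e
    exact ⟨fun he => ((Set.ext_iff.1 h e.1).1 ⟨he, e.2⟩).1,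
      fun he => ((Set.ext_iff.1 h e.1).2 ⟨he, e.2⟩).1⟩

theorem edgesIn_inter : edgesIn X (T ∩ X) = edgesIn X T :=
  edgesIn_eq_iff.2 (by rw [Set.inter_assoc, Set.inter_self])

theorem edgesIn_eq_univ_iff : edgesIn X T = Set.univ ↔ X ⊆ T := by
  rw [Set.eq_univ_iff_forall]
  exact ⟨fun h e he => h ⟨e, he⟩, fun h e => h e.2⟩

theorem touches_sub_iff {v : (Γ.sub X).V} :
    (Γ.sub X).Touches (edgesIn X T) v ↔ Γ.Touches (T ∩ X) v.1 := by
  constructor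
  · rintro ⟨e, he, h⟩
    exact ⟨e.1, ⟨he, e.2⟩, h.imp (congrArg Subtype.val) (congrArg Subtype.val)⟩
  · rintro ⟨e, ⟨he, heX⟩, h⟩
    exact ⟨⟨e, heX⟩, he, h.imp Subtype.ext Subtype.ext⟩

theorem conn_sub_iff {v w : (Γ.sub X).V} :
    ((Γ.sub X).conn (edgesIn X T)) v w ↔ (Γ.conn (T ∩ X)) v.1 w.1 := by
  constructor
  · exact conn_le (Γ := Γ.sub X) (r := (Γ.conn (T ∩ X)).comap Subtype.val) fun e he =>
      conn_edge (e := e.1) ⟨he, e.2⟩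
  -- The generated equivalence relation also relates every vertex outside `Γ.sub X` to itself. The
  -- alternative `v = w` absorbs these pairs and keeps the induction within `Γ`.
  · have key : ∀ v w, (Γ.conn (T ∩ X)) v w → v = w ∨
        ∃ (hv : Γ.Touches X v) (hw : Γ.Touches X w),
          ((Γ.sub X).conn (edgesIn X T)) ⟨v, hv⟩ ⟨w, hw⟩ := by
      intro v w h
      induction h with
      | rel v w h =>
        obtain ⟨e, ⟨he, heX⟩, rfl, rfl⟩ := h
        exact Or.inr ⟨touches_src heX, touches_tgt heX,
          conn_edge (Γ := Γ.sub X) (e := ⟨e, heX⟩) he⟩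
      | refl => exact Or.inl rfl
      | symm _ _ _ ih =>
        exact ih.imp Eq.symm fun ⟨hv, hw, h⟩ => ⟨hw, hv, ((Γ.sub X).conn _).symm' h⟩
      | trans _ _ _ _ _ ih1 ih2 =>
        rcases ih1 with rfl | ⟨hu, hv, h1⟩
        · exact ih2
        · rcases ih2 with rfl | ⟨hv', hw, h2⟩
          · exact Or.inr ⟨hu, hv, h1⟩
          · exact Or.inr ⟨hu, hw, ((Γ.sub X).conn _).trans' h1 h2⟩
    intro h
    rcases key _ _ h with h | ⟨_, _, h⟩
    · rw [Subtype.ext h]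
    · exact h

theorem trace_edgesIn_iff {c : Fin 4} {a : (Γ.sub X).A} {b : (Γ.sub X).B} :
    (Γ.sub X).Trace (edgesIn X T) c a b ↔ Γ.Trace (T ∩ X) c a.1 b.1 := by
  constructor
  · intro h
    induction h with
    | vertex h => exact Trace.vertex h
    | @propagator a e b he h _ ih => exact Trace.propagator (e := e.1) ⟨he, e.2⟩ h ih
  · obtain ⟨a, ha⟩ := a
    obtain ⟨b, hb⟩ := b
    intro h
    change Γ.Trace _ c a b at h
    induction h with
    | vertex h => exact Trace.vertex h
    | @propagator a e b he h _ ih =>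
      exact @Trace.propagator (Γ.sub X) _ c ⟨a, ha⟩ ⟨e, he.2⟩ ⟨b, hb⟩ he.1 h
        (ih (touches_tgt he.2) hb)

theorem isComp_edgesIn_iff (hC : C ⊆ X) :
    (Γ.sub X).IsComp (edgesIn X T) (edgesIn X C) ↔ Γ.IsComp (T ∩ X) C := by
  have hCX : C ∩ X = C := Set.inter_eq_left.2 hC
  constructor
  · intro h
    refine ⟨h.nonempty.image Subtype.val |>.mono ?_, fun e he => ⟨h.subset
      (a := ⟨e, hC he⟩) he, hC he⟩, ?_, ?_⟩
    · rintro _ ⟨e, he, rfl⟩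
      exact he
    · rintro e ⟨he, heX⟩ h'
      refine h.closed ⟨e, heX⟩ he ?_
      rwa [touches_sub_iff, touches_sub_iff, hCX]
    · intro v w hv hw
      have h1 := h.connected ⟨v, hv.mono hC⟩ ⟨w, hw.mono hC⟩
        (touches_sub_iff.2 (hCX.symm ▸ hv)) (touches_sub_iff.2 (hCX.symm ▸ hw))
      exact hCX ▸ conn_sub_iff.1 h1
  · intro h
    refine ⟨?_, fun e he => (h.subset he).1, ?_, ?_⟩
    · obtain ⟨e, he⟩ := h.nonempty
      exact ⟨⟨e, hC he⟩, he⟩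
    · intro e he h'
      rw [touches_sub_iff, touches_sub_iff, hCX] at h'
      exact h.closed e.1 ⟨he, e.2⟩ h'
    · intro v w hv hw
      rw [touches_sub_iff, hCX] at hv hw
      rw [conn_sub_iff, hCX]
      exact h.connected _ _ hv hw

variable (T) in
/-- A subgraph of a subgraph is a subgraph. -/
def isoSubSub (X : Set Γ.E) : Iso ((Γ.sub X).sub (edgesIn X T)) (Γ.sub (T ∩ X)) :=
  have h : ∀ v, Γ.Touches (T ∩ X) v → Γ.Touches X v := fun _ => Touches.mono Set.inter_subset_right
  Iso.ofBijective
    (fun v => ⟨v.1.1, touches_sub_iff.1 v.2⟩) (fun a => ⟨a.1.1, touches_sub_iff.1 a.2⟩)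
    (fun b => ⟨b.1.1, touches_sub_iff.1 b.2⟩) (fun e => ⟨e.1.1, e.2, e.1.2⟩)
    ⟨Function.Injective.of_comp (f := Subtype.val) val_val_injective,
      fun v => ⟨⟨⟨v.1, h _ v.2⟩, touches_sub_iff.2 v.2⟩, rfl⟩⟩
    ⟨Function.Injective.of_comp (f := Subtype.val) val_val_injective,
      fun a => ⟨⟨⟨a.1, h _ a.2⟩, touches_sub_iff.2 a.2⟩, rfl⟩⟩
    ⟨Function.Injective.of_comp (f := Subtype.val) val_val_injective,
      fun b => ⟨⟨⟨b.1, h _ b.2⟩, touches_sub_iff.2 b.2⟩, rfl⟩⟩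
    ⟨Function.Injective.of_comp (f := Subtype.val) val_val_injective,
      fun e => ⟨⟨⟨e.1, e.2.2⟩, e.2.1⟩, rfl⟩⟩
    (fun _ => rfl) (fun _ => rfl) (fun _ _ _ => Iff.rfl) (fun _ => rfl) (fun _ => rfl)
    (fun _ => rfl)

/-- If all vertices are ends of edges, the subgraph with all edges is the whole graph. -/
def isoSubUniv (h : ∀ v, Γ.Touches Set.univ v) : Iso (Γ.sub Set.univ) Γ :=
  Iso.ofBijective Subtype.val Subtype.val Subtype.val Subtype.val
    ⟨Subtype.val_injective, fun v => ⟨⟨v, h v⟩, rfl⟩⟩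
    ⟨Subtype.val_injective, fun a => ⟨⟨a, h _⟩, rfl⟩⟩
    ⟨Subtype.val_injective, fun b => ⟨⟨b, h _⟩, rfl⟩⟩
    ⟨Subtype.val_injective, fun e => ⟨⟨e, trivial⟩, rfl⟩⟩
    (fun _ => rfl) (fun _ => rfl) (fun _ _ _ => Iff.rfl) (fun _ => rfl) (fun _ => rfl)
    (fun _ => rfl)

/-- A connected graph with an edge has no isolated vertex. Without this the subgraph on all edges
could lose vertices. -/
theorem IsOnePI.touches (h : Γ.IsOnePI) (v : Γ.V) : Γ.Touches Set.univ v := by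
  obtain ⟨e⟩ := h.1
  have hc : Γ.ClosedIn Set.univ Set.univ := fun _ _ _ => trivial
  exact (hc.touches_and_conn (h.2.2.1 (Γ.vA (Γ.tgt e)) v)).1.1 (touches_tgt trivial)

theorem IsOnePI.isComp_univ (h : Γ.IsOnePI) : Γ.IsComp Set.univ Set.univ where
  nonempty := h.1.elim fun e => ⟨e, trivial⟩
  subset := subset_rfl
  closed _ _ _ := trivial
  connected v w _ _ := h.2.2.1 v w

end Sub

/-! ### Edge sets, strands and components of a contraction -/

section Contract

variable {ω : StrandedGraph → ℤ}

variable (ω) in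
/-- The edges of the contraction `Γ.contract ω T` that belong to `S`. -/
def edgesMod (T S : Set Γ.E) : Set (Γ.contract ω T).E := {e | e.1 ∈ S}

theorem edgesMod_image_union (S' : Set (Γ.contract ω T).E) :
    ∃ S, T ⊆ S ∧ S' = edgesMod ω T S := by
  refine ⟨T ∪ Subtype.val '' S', Set.subset_union_left, ?_⟩
  ext e
  constructor
  · exact fun he => Or.inr ⟨e, he, rfl⟩
  · rintro (h | ⟨e', he', h⟩)
    · exact (e.2 h).elim
    · rwa [← Subtype.ext h]

/-- Together with `edgesMod_image_union`, this makes `S ↦ S/T` a bijection from the edge sets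
containing `T` to all edge sets of `Γ/T`. -/
theorem edgesMod_injOn (hS : T ⊆ S) (hX : T ⊆ X) (h : edgesMod ω T S = edgesMod ω T X) :
    S = X := by
  ext e
  by_cases he : e ∈ T
  · exact iff_of_true (hS he) (hX he)
  · exact Set.ext_iff.1 h ⟨e, he⟩

theorem edgesMod_eq_univ_iff (hS : T ⊆ S) : edgesMod ω T S = Set.univ ↔ S = Set.univ := by
  constructor
  · exact fun h => edgesMod_injOn hS (Set.subset_univ _) (h.trans rfl)
  · rintro rfl
    rfl

theorem conn_contract_iff (hTS : T ⊆ S) {v w : Γ.V} :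
    ((Γ.contract ω T).conn (edgesMod ω T S)) (Quotient.mk (Γ.conn T) v)
      (Quotient.mk (Γ.conn T) w) ↔ (Γ.conn S) v w := by
  refine ⟨fun h => ?_, conn_contract fun _ _ h => h⟩
  -- The map from `T`-classes to `S`-classes identifies the two ends of every edge of `S/T`, so its
  -- kernel contains the relation generated by these edges.
  let r : Setoid (Γ.contract ω T).V := Setoid.ker
    (Quotient.lift (Quotient.mk (Γ.conn S)) fun v w h => Quotient.sound (conn_mono hTS h))
  exact Quotient.exact (conn_le (r := r) (fun e he => Quotient.sound (conn_edge he)) h)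

theorem Trace.comp {c : Fin 4} {a : Γ.A} {e : Γ.E} {b : Γ.B} (h : Γ.Trace S c a (Γ.src e))
    (he : e ∈ S) (h' : Γ.Trace S c (Γ.tgt e) b) : Γ.Trace S c a b := by
  generalize hb : Γ.src e = b' at h
  induction h with
  | vertex h => exact Trace.propagator he (hb ▸ h) h'
  | propagator he' h1 _ ih => exact Trace.propagator he' h1 (ih hb)

theorem Trace.mono {c : Fin 4} {a : Γ.A} {b : Γ.B} (hTS : T ⊆ S) (h : Γ.Trace T c a b) :
    Γ.Trace S c a b := by
  induction h with
  | vertex h => exact Trace.vertex h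
  | propagator he h _ ih => exact Trace.propagator (hTS he) h ih

theorem trace_contract_iff (hTS : T ⊆ S) {c : Fin 4} {a : (Γ.contract ω T).A}
    {b : (Γ.contract ω T).B} :
    (Γ.contract ω T).Trace (edgesMod ω T S) c a b ↔ Γ.Trace S c a.1 b.1 := by
  constructor
  · intro h
    induction h with
    | vertex h => exact Trace.mono hTS h
    | propagator he h _ ih => exact Trace.comp (Trace.mono hTS h) he ih
  · obtain ⟨a, ha⟩ := a
    obtain ⟨b, hb⟩ := b
    intro h
    change Γ.Trace S c a b at h
    -- The strand is cut at its first propagator outside `T`; the piece before the cut is one strand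
    -- of a vertex of `Γ/T`.
    have key : Γ.Trace T c a b ∨ ∃ e : (Γ.contract ω T).E, e ∈ edgesMod ω T S ∧
        Γ.Trace T c a (Γ.src e.1) ∧
        (Γ.contract ω T).Trace (edgesMod ω T S) c ((Γ.contract ω T).tgt e) ⟨b, hb⟩ := by
      -- A tail of the strand may start at the end of a propagator in `T`, which is not a field of
      -- `Γ/T`, so the induction must not require `ha` of it.
      clear ha
      induction h with
      | vertex h => exact Or.inl (Trace.vertex h)
      | @propagator a e b he h _ ih =>
        by_cases heT : e ∈ T
        · rcases ih hb with h1 | ⟨e', he', h1, h2⟩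
          · exact Or.inl (Trace.propagator heT h h1)
          · exact Or.inr ⟨e', he', Trace.propagator heT h h1, h2⟩
        · refine Or.inr ⟨⟨e, heT⟩, he, Trace.vertex h, ?_⟩
          rcases ih hb with h1 | ⟨e', he', h1, h2⟩
          · exact Trace.vertex h1
          · exact Trace.propagator he' h1 h2
    rcases key with h1 | ⟨e', he', h1, h2⟩
    · exact Trace.vertex h1
    · exact Trace.propagator he' h1 h2

/-- A vertex class of the contraction is an end of an edge in `X` iff it consists of such ends,
provided that `X` is closed. -/
theorem touches_contract_of (hX : Γ.ClosedIn T X) {v : Γ.V}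
    (h : (Γ.contract ω T).Touches (edgesMod ω T X) (Quotient.mk (Γ.conn T) v)) :
    Γ.Touches X v := by
  obtain ⟨e, he, h | h⟩ := h
  · exact (hX.touches_and_conn (Quotient.exact h)).1.1 (touches_src he)
  · exact (hX.touches_and_conn (Quotient.exact h)).1.1 (touches_tgt he)

/-- An edge of `X` outside `T` survives the contraction, and connectedness of `X` joins every vertex
of `X` to its end. If `X ⊆ T`, no edge would survive. -/
theorem IsComp.touches_contract (hX : Γ.IsComp S X) (hXT : ¬ X ⊆ T) {v : Γ.V}
    (hv : Γ.Touches X v) :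
    (Γ.contract ω T).Touches (edgesMod ω T X) (Quotient.mk (Γ.conn T) v) := by
  obtain ⟨e, heX, heT⟩ := Set.not_subset.1 hXT
  have hcl : (Γ.contract ω T).ClosedIn (edgesMod ω T X) (edgesMod ω T X) := fun e he _ => he
  have h1 : ((Γ.contract ω T).conn (edgesMod ω T X)) (Quotient.mk (Γ.conn T) (Γ.vA (Γ.tgt e)))
    (Quotient.mk (Γ.conn T) v) := conn_contract (fun _ _ h => h)
      (hX.connected _ _ (touches_tgt heX) hv)
  exact (hcl.touches_and_conn h1).1.1 (touches_tgt (Γ := Γ.contract ω T) (e := ⟨e, heT⟩) heX)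

theorem IsComp.mod (hX : Γ.IsComp S X) (hTS : T ⊆ S) (hXT : ¬ X ⊆ T) :
    (Γ.contract ω T).IsComp (edgesMod ω T S) (edgesMod ω T X) where
  nonempty := by
    obtain ⟨e, heX, heT⟩ := Set.not_subset.1 hXT
    exact ⟨⟨e, heT⟩, heX⟩
  subset _ he := hX.subset he
  closed e he h' := by
    have hXcl := hX.closed.mono hTS
    exact hX.closed e.1 he (h'.imp (touches_contract_of hXcl) (touches_contract_of hXcl))
  connected v w hv hw := by
    have hXcl := hX.closed.mono hTS
    induction v using Quotient.ind
    induction w using Quotient.ind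
    exact conn_contract (fun _ _ h => h)
      (hX.connected _ _ (touches_contract_of hXcl hv) (touches_contract_of hXcl hw))

/-- Each surviving edge lies in a unique component of `S`, and components inside `T` have no
surviving edge. -/
theorem isComp_edgesMod_iff (hTS : T ⊆ S) {C' : Set (Γ.contract ω T).E} :
    (Γ.contract ω T).IsComp (edgesMod ω T S) C' ↔
      ∃ X : Set Γ.E, Γ.IsComp S X ∧ ¬ X ⊆ T ∧ C' = edgesMod ω T X := by
  constructor
  · intro h
    obtain ⟨e, he⟩ := h.nonempty
    obtain ⟨X, hX, heX⟩ := exists_isComp (Γ := Γ) (e := e.1) (h.subset he)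
    have hXT : ¬ X ⊆ T := fun h => e.2 (h heX)
    exact ⟨X, hX, hXT, h.eq_of_mem (hX.mod hTS hXT) he heX⟩
  · rintro ⟨X, hX, hXT, rfl⟩
    exact hX.mod hTS hXT

end Contract

end StrandedGraph

/-! ### Contraction inside a component and in two steps -/

theorem injective_of_comp_eq {α β γ : Type*} {f : β → γ} {g : β → α} (hg : Function.Injective g)
    (h : γ → α) (hfg : ∀ x, h (f x) = g x) : Function.Injective f :=
  fun x y hxy => hg (by rw [← hfg, hxy, hfg])

namespace StrandedGraph

variable {Γ : StrandedGraph} {X S T C : Set Γ.E} {ω : StrandedGraph → ℤ}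

theorem trace_empty_iff {c : Fin 4} {a : Γ.A} {b : Γ.B} :
    Γ.Trace ∅ c a b ↔ Γ.strand c a b :=
  trace_of_comp_empty fun ⟨_, h⟩ => h.1

/-- Contracting no edges does not change the graph. -/
def isoContractEmpty (ω : StrandedGraph → ℤ) (Γ : StrandedGraph) : Iso Γ (Γ.contract ω ∅) :=
  have h : ∀ x, ¬ (Γ.comp ∅ x).Nonempty := fun _ ⟨_, h⟩ => h.1
  Iso.ofBijective (Γ' := Γ.contract ω ∅) (fun v => Quotient.mk (Γ.conn ∅) v)
    (fun a => ⟨a, fun _ h => h.elim⟩) (fun b => ⟨b, fun _ h => h.elim⟩) (fun e => ⟨e, id⟩)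
    ⟨fun _ _ h' => eq_of_conn_of_comp_empty (Quotient.exact h') (h _), Quotient.mk_surjective⟩
    ⟨fun _ _ h => congrArg Subtype.val h, fun a => ⟨a.1, rfl⟩⟩
    ⟨fun _ _ h => congrArg Subtype.val h, fun b => ⟨b.1, rfl⟩⟩
    ⟨fun _ _ h => congrArg Subtype.val h, fun e => ⟨e.1, rfl⟩⟩
    (fun _ => rfl) (fun _ => rfl) (fun _ _ _ => trace_empty_iff) (fun _ => rfl) (fun _ => rfl)
    (fun v => (contract_deg_mk ω ∅ v).trans (if_neg (h _)))

theorem comp_edgesIn (v : (Γ.sub X).V) (hX : Γ.ClosedIn T X) :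
    (Γ.sub X).comp (edgesIn X T) (Quotient.mk _ v) =
      edgesIn X (Γ.comp T (Quotient.mk _ v.1)) := by
  ext e
  rw [mem_comp_iff, mem_edgesIn, mem_edgesIn, mem_comp_iff, Quotient.eq, Quotient.eq]
  refine and_congr_right fun _ => conn_sub_iff.trans
    ⟨conn_mono Set.inter_subset_left, fun h => ?_⟩
  exact (hX.touches_and_conn h).2 (touches_tgt e.2)

theorem ClosedIn.comp_subset (hX : Γ.ClosedIn T X) {v : Γ.V} (hv : Γ.Touches X v) :
    Γ.comp T (Quotient.mk _ v) ⊆ X := by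
  rintro e ⟨he, h⟩
  exact hX e he (Or.inr ((hX.touches_and_conn (Quotient.exact h)).1.2 hv))

/-- Contraction in a component: the contraction of `T` in the component `X` of `S ⊇ T` is a
subgraph of the contraction of `T`. -/
theorem IsComp.isoSubContract
    (hω : ∀ Γ Γ' : StrandedGraph, Nonempty (StrandedGraph.Iso Γ Γ') → ω Γ = ω Γ')
    (hX : Γ.IsComp S X) (hTS : T ⊆ S) (hXT : ¬ X ⊆ T) :
    Nonempty (Iso ((Γ.sub X).contract ω (edgesIn X T))
      ((Γ.contract ω T).sub (edgesMod ω T X))) := by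
  classical
  have hcl := hX.closed.mono hTS
  refine ⟨Iso.ofBijective (Γ := (Γ.sub X).contract ω (edgesIn X T))
    (Γ' := (Γ.contract ω T).sub (edgesMod ω T X))
    (Quotient.lift (fun v => ⟨Quotient.mk (Γ.conn T) v.1, hX.touches_contract hXT v.2⟩)
      fun v w h => Subtype.ext (Quotient.sound
        (conn_mono Set.inter_subset_left (conn_sub_iff.1 h))))
    (fun a => ⟨⟨a.1.1, fun e he h => a.2 ⟨e, ?_⟩ he (Subtype.ext h)⟩,
      hX.touches_contract hXT a.1.2⟩)
    (fun b => ⟨⟨b.1.1, fun e he h => b.2 ⟨e, ?_⟩ he (Subtype.ext h)⟩,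
      hX.touches_contract hXT b.1.2⟩)
    (fun e => ⟨⟨e.1.1, e.2⟩, e.1.2⟩)
    ⟨?_, ?_⟩
    ⟨injective_of_comp_eq val_val_injective (fun x => x.1.1) fun _ => rfl, fun a =>
      ⟨⟨⟨a.1.1, touches_contract_of hcl a.2⟩, fun e he h => a.1.2 e.1 he (congrArg Subtype.val h)⟩,
        rfl⟩⟩
    ⟨injective_of_comp_eq val_val_injective (fun x => x.1.1) fun _ => rfl, fun b =>
      ⟨⟨⟨b.1.1, touches_contract_of hcl b.2⟩, fun e he h => b.1.2 e.1 he (congrArg Subtype.val h)⟩,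
        rfl⟩⟩
    ⟨injective_of_comp_eq val_val_injective (fun x => x.1.1) fun _ => rfl, fun e =>
      ⟨⟨⟨e.1.1, e.2⟩, e.1.2⟩, rfl⟩⟩
    (fun _ => rfl) (fun _ => rfl) ?_ (fun _ => rfl) (fun _ => rfl) ?_⟩
  -- An edge of `T` that ends at a vertex of `X` lies in `X`, so the field is external to all of `T`
  -- once it is external to `T ∩ X`.
  · exact hcl e he (Or.inr (h ▸ a.1.2))
  · exact hcl e he (Or.inl (h ▸ b.1.2))
  · intro v w h
    induction v using Quotient.ind with | _ v
    induction w using Quotient.ind with | _ w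
    have h1 := congrArg Subtype.val h
    exact Quotient.sound (conn_sub_iff.2 ((hcl.touches_and_conn (Quotient.exact h1)).2 v.2))
  · rintro ⟨v, hv⟩
    induction v using Quotient.ind with | _ v
    exact ⟨Quotient.mk _ ⟨v, touches_contract_of hcl hv⟩, rfl⟩
  · intro c a b
    refine Iff.trans ?_ trace_edgesIn_iff.symm
    refine ⟨fun h => ?_, Trace.mono Set.inter_subset_left⟩
    -- A strand that starts in the component `X` and follows edges of `T` stays in `X`.
    have key : ∀ (a : Γ.A) (b : Γ.B), Γ.Trace T c a b → Γ.Touches X (Γ.vA a) →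
        Γ.Trace (T ∩ X) c a b := by
      intro a b h
      induction h with
      | vertex h => exact fun _ => Trace.vertex h
      | @propagator a e b he h _ ih =>
        intro ha
        rw [Γ.strand_local _ _ _ h] at ha
        have heX := hcl e he (Or.inl ha)
        exact Trace.propagator ⟨he, heX⟩ h (ih (touches_tgt heX))
    exact key _ _ h a.1.2
  · intro x
    induction x using Quotient.ind with | _ v
    refine (contract_deg_mk ω T v.1).trans ((contract_deg_mk ω (edgesIn X T) v).trans ?_).symm
    have hsub := hcl.comp_subset v.2
    have hiff : (edgesIn X (Γ.comp T (Quotient.mk _ v.1))).Nonempty ↔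
        (Γ.comp T (Quotient.mk _ v.1)).Nonempty :=
      ⟨fun ⟨e, he⟩ => ⟨e.1, he⟩, fun ⟨e, he⟩ => ⟨⟨e, hsub he⟩, he⟩⟩
    rw [comp_edgesIn v hcl]
    refine if_congr hiff ?_ rfl
    exact hω _ _ ⟨(isoSubSub _ X).trans (isoSubOfEq (Set.inter_eq_left.2 hsub))⟩

theorem comp_edgesMod (hTS : T ⊆ S) (v : Γ.V) :
    (Γ.contract ω T).comp (edgesMod ω T S) (Quotient.mk _ (Quotient.mk (Γ.conn T) v)) =
      edgesMod ω T (Γ.comp S (Quotient.mk _ v)) := by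
  ext e
  refine and_congr_right fun _ => Quotient.eq.trans (Iff.trans ?_ Quotient.eq.symm)
  exact conn_contract_iff hTS

/-- Contraction in two steps. -/
theorem isoContractContract (hTS : T ⊆ S)
    (hdeg : ∀ X, Γ.IsComp S X → ¬ X ⊆ T →
      ω ((Γ.contract ω T).sub (edgesMod ω T X)) = ω (Γ.sub X)) :
    Nonempty (Iso (Γ.contract ω S) ((Γ.contract ω T).contract ω (edgesMod ω T S))) := by
  refine ⟨Iso.ofBijective (Γ := Γ.contract ω S)
    (Γ' := (Γ.contract ω T).contract ω (edgesMod ω T S))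
    (Quotient.lift (fun v => Quotient.mk _ (Quotient.mk (Γ.conn T) v))
      fun v w h => Quotient.sound ((conn_contract_iff hTS).2 h))
    (fun a => ⟨⟨a.1, fun e he => a.2 e (hTS he)⟩, fun e he h =>
      a.2 e.1 he (congrArg Subtype.val h)⟩)
    (fun b => ⟨⟨b.1, fun e he => b.2 e (hTS he)⟩, fun e he h =>
      b.2 e.1 he (congrArg Subtype.val h)⟩)
    (fun e => ⟨⟨e.1, fun he => e.2 (hTS he)⟩, e.2⟩)
    ⟨?_, ?_⟩
    ⟨injective_of_comp_eq Subtype.val_injective (fun x => x.1.1) fun _ => rfl, fun a => ⟨⟨a.1.1, fun e he h => ?_⟩, rfl⟩⟩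
    ⟨injective_of_comp_eq Subtype.val_injective (fun x => x.1.1) fun _ => rfl, fun b => ⟨⟨b.1.1, fun e he h => ?_⟩, rfl⟩⟩
    ⟨injective_of_comp_eq Subtype.val_injective (fun x => x.1.1) fun _ => rfl, fun e => ⟨⟨e.1.1, e.2⟩, rfl⟩⟩
    (fun _ => rfl) (fun _ => rfl) (fun _ _ _ => trace_contract_iff hTS)
    (fun _ => rfl) (fun _ => rfl) ?_⟩
  · intro v w h
    induction v using Quotient.ind with | _ v
    induction w using Quotient.ind with | _ w
    exact Quotient.sound ((conn_contract_iff hTS).1 (Quotient.exact h))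
  · intro x
    induction x using Quotient.ind with | _ x
    induction x using Quotient.ind with | _ v
    exact ⟨Quotient.mk _ v, rfl⟩
  · by_cases heT : e ∈ T
    · exact a.1.2 e heT h
    · exact a.2 ⟨e, heT⟩ he (Subtype.ext h)
  · by_cases heT : e ∈ T
    · exact b.1.2 e heT h
    · exact b.2 ⟨e, heT⟩ he (Subtype.ext h)
  · intro x
    induction x using Quotient.ind with | _ v
    refine (contract_deg_mk (Γ := Γ.contract ω T) ω (edgesMod ω T S) (Quotient.mk _ v)).trans
      ((contract_deg_mk ω S v).trans ?_).symm
    rw [comp_edgesMod hTS]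
    -- There are three kinds of vertices: those in a component of `S` already contracted with `T`,
    -- whose degree was assigned in the first step; those in a component contracted in the second
    -- step, where `hdeg` applies; and those that `S` does not meet, which keep their degree.
    by_cases hX : (Γ.comp S (Quotient.mk _ v)).Nonempty
    · rw [if_pos hX]
      have hXc := isComp_comp hX
      by_cases hXT : Γ.comp S (Quotient.mk _ v) ⊆ T
      · have hXT' := hXc.of_subset hTS hXT
        have heq := hXT'.eq_comp ((touches_comp_iff hX).2 rfl)
        rw [if_neg (fun ⟨e, he⟩ => e.2 (hXT he)), contract_deg_mk ω T v, ← heq, if_pos hX]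
      · rw [if_pos, hdeg _ hXc hXT]
        obtain ⟨e, he, heT⟩ := Set.not_subset.1 hXT
        exact ⟨⟨e, heT⟩, he⟩
    · rw [if_neg hX, if_neg (fun ⟨e, he⟩ => hX ⟨e.1, he⟩), contract_deg_mk ω T v, if_neg]
      rintro ⟨e, he, h⟩
      exact hX ⟨e, hTS he, Quotient.sound (conn_mono hTS (Quotient.exact h))⟩

end StrandedGraph

/-! ### Reinsertion, and divergence before and after contraction -/

namespace StrandedGraph

variable {Γ : StrandedGraph} {X S T C : Set Γ.E} {ω : StrandedGraph → ℤ}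

theorem trace_sub_univ_iff {c : Fin 4} {a : (Γ.sub C).A} {b : (Γ.sub C).B} :
    (Γ.sub C).Trace Set.univ c a b ↔ Γ.Trace C c a.1 b.1 := by
  have h := trace_edgesIn_iff (T := Set.univ) (c := c) (a := a) (b := b)
  rwa [Set.univ_inter] at h

/-- The gluing data for reinserting a contracted connected subgraph. -/
def contractGluing (ω : StrandedGraph → ℤ) {v₀ : (Γ.contract ω C).V}
    (hv : ∀ v, Quotient.mk (Γ.conn C) v = v₀ ↔ Γ.Touches C v) :
    Gluing (Γ.sub C) (Γ.contract ω C) v₀ where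
  α :=
    { toFun := fun a => ⟨⟨a.1.1, (hv _).1 a.2⟩, fun e he => a.1.2 e.1 e.2 (congrArg Subtype.val he)⟩
      invFun := fun a => ⟨⟨a.1.1, fun e he h => a.2 ⟨e, he⟩ (Subtype.ext h)⟩, (hv _).2 a.1.2⟩
      left_inv := fun _ => rfl
      right_inv := fun _ => rfl }
  β :=
    { toFun := fun b => ⟨⟨b.1.1, (hv _).1 b.2⟩, fun e he => b.1.2 e.1 e.2 (congrArg Subtype.val he)⟩
      invFun := fun b => ⟨⟨b.1.1, fun e he h => b.2 ⟨e, he⟩ (Subtype.ext h)⟩, (hv _).2 b.1.2⟩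
      left_inv := fun _ => rfl
      right_inv := fun _ => rfl }
  strand_iff _ a b := (trace_sub_univ_iff (a := ⟨a.1.1, (hv _).1 a.2⟩)
    (b := ⟨b.1.1, (hv _).1 b.2⟩)).symm

theorem IsComp.mk_eq_iff (hC : Γ.IsComp C C) {v₀ : Γ.V} (h₀ : Γ.Touches C v₀) (v : Γ.V) :
    Quotient.mk (Γ.conn C) v = Quotient.mk (Γ.conn C) v₀ ↔ Γ.Touches C v :=
  Quotient.eq.trans ⟨fun h => (hC.closed.touches_and_conn h).1.2 h₀,
    fun h => hC.connected _ _ h h₀⟩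

/-- Reinserting a contracted connected subgraph recovers the graph. -/
theorem isoInsertAt_contract {v₀ : (Γ.contract ω C).V}
    (hv : ∀ v, Quotient.mk (Γ.conn C) v = v₀ ↔ Γ.Touches C v) :
    Nonempty (Iso (insertAt (Γ.sub C) (Γ.contract ω C) v₀ (contractGluing ω hv)) Γ) := by
  classical
  have hempty : ∀ v, ¬ Γ.Touches C v → ¬ (Γ.comp C (Quotient.mk _ v)).Nonempty := by
    rintro v hv' h
    exact hv' (((touches_comp_iff h).2 rfl).mono fun _ h => h.1)
  -- Vertices outside `C` form singleton classes, so `out` gives back the original vertex.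
  have hout : ∀ v, ¬ Γ.Touches C v → (Quotient.mk (Γ.conn C) v).out = v := fun v h =>
    (eq_of_conn_of_comp_empty (Quotient.exact (Quotient.out_eq _).symm) (hempty v h)).symm
  have hne : ∀ w : {w : Quotient (Γ.conn C) // w ≠ v₀}, ¬ Γ.Touches C w.1.out := fun w h =>
    w.2 ((Quotient.out_eq _).symm.trans ((hv _).2 h))
  refine ⟨Iso.ofBijective
    (Γ := insertAt (Γ.sub C) (Γ.contract ω C) v₀ (contractGluing ω hv))
    (Sum.elim Subtype.val fun w : {w : Quotient (Γ.conn C) // w ≠ v₀} => w.1.out)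
    (Sum.elim Subtype.val fun a => a.1.1) (Sum.elim Subtype.val fun b => b.1.1)
    (Sum.elim Subtype.val Subtype.val)
    ⟨Subtype.val_injective.sumElim ?_ ?_, fun v => ?_⟩
    ⟨Subtype.val_injective.sumElim val_val_injective ?_, fun a => ?_⟩
    ⟨Subtype.val_injective.sumElim val_val_injective ?_, fun b => ?_⟩
    ⟨Subtype.val_injective.sumElim Subtype.val_injective ?_, fun e => ?_⟩
    ?_ ?_ ?_ ?_ ?_ ?_⟩
  · intro v w h
    exact Subtype.ext ((Quotient.out_eq _).symm.trans ((congrArg _ h).trans (Quotient.out_eq _)))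
  · exact fun v w h => hne w (h ▸ v.2)
  · by_cases h : Γ.Touches C v
    · exact ⟨Sum.inl ⟨v, h⟩, rfl⟩
    · exact ⟨Sum.inr ⟨Quotient.mk _ v, fun h' => h ((hv v).1 h')⟩, hout v h⟩
  · exact fun a a' h => a'.2 ((hv _).2 (h ▸ a.2))
  · by_cases h : Γ.Touches C (Γ.vA a)
    · exact ⟨Sum.inl ⟨a, h⟩, rfl⟩
    · exact ⟨Sum.inr ⟨⟨a, fun e he h' => h (h' ▸ touches_tgt he)⟩, fun h' => h ((hv _).1 h')⟩, rfl⟩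
  · exact fun b b' h => b'.2 ((hv _).2 (h ▸ b.2))
  · by_cases h : Γ.Touches C (Γ.vB b)
    · exact ⟨Sum.inl ⟨b, h⟩, rfl⟩
    · exact ⟨Sum.inr ⟨⟨b, fun e he h' => h (h' ▸ touches_src he)⟩, fun h' => h ((hv _).1 h')⟩, rfl⟩
  · exact fun e e' h => e'.2 (h ▸ e.2)
  · by_cases h : e ∈ C
    · exact ⟨Sum.inl ⟨e, h⟩, rfl⟩
    · exact ⟨Sum.inr ⟨e, h⟩, rfl⟩
  · rintro (a | a)
    · rfl
    · exact (hout _ fun h => a.2 ((hv _).2 h)).symm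
  · rintro (b | b)
    · rfl
    · exact (hout _ fun h => b.2 ((hv _).2 h)).symm
  · rintro c (a | a) (b | b)
    · exact Iff.rfl
    · refine iff_of_false (fun h => b.2 ((hv _).2 ?_)) id
      exact Γ.strand_local _ _ _ h ▸ a.2
    · refine iff_of_false (fun h => a.2 ((hv _).2 ?_)) id
      exact (Γ.strand_local _ _ _ h).symm ▸ b.2
    · exact (trace_of_comp_empty (hempty _ fun h => a.2 ((hv _).2 h))).symm
  · rintro (e | e)
    · rfl
    · change Γ.src e.1 = Sum.elim _ _ (dite _ _ _)
      split_ifs <;> rfl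
  · rintro (e | e)
    · rfl
    · change Γ.tgt e.1 = Sum.elim _ _ (dite _ _ _)
      split_ifs <;> rfl
  · rintro (v | v)
    · rfl
    · refine (if_neg fun h => hne v ?_).symm
      exact ((touches_comp_iff h).2 (Quotient.out_eq _)).mono fun _ h => h.1

/-- Closure under contraction gives one direction. For the other, `Γ` is the insertion of `Γ.sub C`
into the vertex to which `C` was shrunk, and the degree of that vertex is `ω (Γ.sub C)` by
construction. -/
theorem IsComp.isSD_contract_iff
    (hω : ∀ Γ Γ' : StrandedGraph, Nonempty (StrandedGraph.Iso Γ Γ') → ω Γ = ω Γ')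
    (hcontr : ClosedUnderContraction ω) (hins : ClosedUnderInsertion ω)
    (hC : Γ.IsComp C C) (hne : C ≠ Set.univ) (hsd : (Γ.sub C).IsSD ω) :
    (Γ.contract ω C).IsSD ω ↔ Γ.IsSD ω := by
  refine ⟨fun h => ?_, fun h => (hcontr Γ C h hne hsd).1⟩
  obtain ⟨e, he⟩ := hC.nonempty
  have hv := hC.mk_eq_iff (touches_tgt he)
  obtain ⟨f⟩ := isoInsertAt_contract (ω := ω) hv
  refine f.isSD hω (hins _ _ _ _ hsd h ((contract_deg_mk ω C _).trans ?_))
  rw [← hC.eq_comp (touches_tgt he), if_pos hC.nonempty]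

/-- Contraction of a divergent set of edges preserves and reflects superficial divergence and
preserves the degree. -/
theorem Divergent.isSD_contract
    (hω : ∀ Γ Γ' : StrandedGraph, Nonempty (StrandedGraph.Iso Γ Γ') → ω Γ = ω Γ')
    (hcontr : ClosedUnderContraction ω) (hins : ClosedUnderInsertion ω)
    (hT : Γ.Divergent ω T) (hne : T ≠ Set.univ) :
    ((Γ.contract ω T).IsSD ω ↔ Γ.IsSD ω) ∧ (Γ.IsSD ω → ω (Γ.contract ω T) = ω Γ) := by
  induction hn : T.ncard using Nat.strong_induction_on generalizing T with
  | _ n ih =>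
    subst hn
    rcases T.eq_empty_or_nonempty with rfl | ⟨e, he⟩
    · have f := isoContractEmpty ω Γ
      exact ⟨⟨f.symm.isSD hω, f.isSD hω⟩, fun _ => (hω _ _ ⟨f⟩).symm⟩
    obtain ⟨C, hC, heC⟩ := exists_isComp he
    have hsub : T \ C ⊂ T := ⟨fun e he => he.1, fun h => (h he).2 heC⟩
    have hT' : Γ.Divergent ω (T \ C) := fun D hD => hT D (hC.isComp_diff_iff.1 hD).1
    have hne' : T \ C ≠ Set.univ := fun h => hne (Set.eq_univ_of_univ_subset (h ▸ hsub.1))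
    obtain ⟨ih1, ih2⟩ := ih _ (Set.ncard_lt_ncard hsub) hT' hne' rfl
    have hCT : ¬ C ⊆ T \ C := fun h => (h heC).2 heC
    -- The components other than `C` are contracted first, by induction, so that only the connected
    -- `C` is left for the second step.
    have honly : ∀ X, Γ.IsComp T X → ¬ X ⊆ T \ C → X = C := by
      intro X hX hXT
      obtain ⟨e', he', h'⟩ := Set.not_subset.1 hXT
      by_contra hXC
      exact h' ⟨hX.subset he', fun heC => hXC (hX.eq_of_mem hC he' heC)⟩
    have hD : edgesMod ω (T \ C) T = edgesMod ω (T \ C) C := by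
      ext e'
      exact ⟨fun h => by_contra fun h' => e'.2 ⟨h, h'⟩, fun h => hC.subset h⟩
    have hDcomp := hC.mod (ω := ω) hsub.1 hCT
    obtain ⟨f⟩ := hC.isoSubContract hω hsub.1 hCT
    have hempty : edgesIn C (T \ C) = ∅ := by
      ext e'
      exact iff_of_false (fun h => h.2 e'.2) id
    -- `C` shares no edge with `T \ C`, so it survives the first contraction unchanged.
    have f' : Iso (Γ.sub C) ((Γ.contract ω (T \ C)).sub (edgesMod ω (T \ C) C)) :=
      (isoContractEmpty ω (Γ.sub C)).trans ((isoContractOfEq ω hempty.symm).trans f)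
    have hsd := f'.isSD hω (hT C hC)
    obtain ⟨k⟩ := isoContractContract (ω := ω) hsub.1 fun X hX hXT => by
      rw [honly X hX hXT]
      exact (hω _ _ ⟨f'⟩).symm
    have hneD : edgesMod ω (T \ C) C ≠ Set.univ := by
      rw [← hD, ne_eq, edgesMod_eq_univ_iff hsub.1]
      exact hne
    rw [hD] at k
    have hiff := hDcomp.self_isComp.isSD_contract_iff hω hcontr hins hneD hsd
    refine ⟨⟨fun h => ih1.1 (hiff.1 (k.isSD hω h)), fun h => k.symm.isSD hω (hiff.2 (ih1.2 h))⟩,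
      fun h => ?_⟩
    rw [hω _ _ ⟨k⟩, (hcontr _ _ (ih1.2 h) hneD hsd).2, ih2 h]

/-- The image of `X` in `Γ/T` is the contraction of `T ∩ X` inside the graph `Γ.sub X`, and this is
a proper contraction because `X` is not contained in `T`. So `Divergent.isSD_contract` applies to
`Γ.sub X`. -/
theorem Divergent.isSD_edgesMod
    (hω : ∀ Γ Γ' : StrandedGraph, Nonempty (StrandedGraph.Iso Γ Γ') → ω Γ = ω Γ')
    (hcontr : ClosedUnderContraction ω) (hins : ClosedUnderInsertion ω)
    (hT : Γ.Divergent ω T) (hTS : T ⊆ S) (hX : Γ.IsComp S X) (hXT : ¬ X ⊆ T) :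
    (((Γ.contract ω T).sub (edgesMod ω T X)).IsSD ω ↔ (Γ.sub X).IsSD ω) ∧
      ((Γ.sub X).IsSD ω → ω ((Γ.contract ω T).sub (edgesMod ω T X)) = ω (Γ.sub X)) := by
  obtain ⟨f⟩ := hX.isoSubContract hω hTS hXT
  have hcl := hX.closed.mono hTS
  have hdiv : (Γ.sub X).Divergent ω (edgesIn X T) := by
    intro C' hC'
    obtain ⟨C, hCX, rfl⟩ := exists_edgesIn C'
    have g := (isoSubSub C X).trans (isoSubOfEq (Set.inter_eq_left.2 hCX))
    exact g.symm.isSD hω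
      (hT C ((isComp_inter_iff hcl).1 ((isComp_edgesIn_iff hCX).1 hC')).1)
  have hne : edgesIn X T ≠ Set.univ := fun h => hXT (edgesIn_eq_univ_iff.1 h)
  obtain ⟨h1, h2⟩ := hdiv.isSD_contract hω hcontr hins hne
  rw [← hω _ _ ⟨f⟩, ← h1]
  refine ⟨⟨f.symm.isSD hω, f.isSD hω⟩, fun h => h2 (h1.1 h)⟩

/-- The divergent sets of edges of `Γ/T` correspond to those of `Γ` that contain `T`. -/
theorem Divergent.divergent_edgesMod_iff
    (hω : ∀ Γ Γ' : StrandedGraph, Nonempty (StrandedGraph.Iso Γ Γ') → ω Γ = ω Γ')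
    (hcontr : ClosedUnderContraction ω) (hins : ClosedUnderInsertion ω)
    (hT : Γ.Divergent ω T) (hTS : T ⊆ S) :
    (Γ.contract ω T).Divergent ω (edgesMod ω T S) ↔ Γ.Divergent ω S := by
  constructor
  · intro h X hX
    by_cases hXT : X ⊆ T
    · exact hT X (hX.of_subset hTS hXT)
    · exact (hT.isSD_edgesMod hω hcontr hins hTS hX hXT).1.1 (h _ (hX.mod hTS hXT))
  · intro h C' hC'
    obtain ⟨X, hX, hXT, rfl⟩ := (isComp_edgesMod_iff hTS).1 hC'
    exact (hT.isSD_edgesMod hω hcontr hins hTS hX hXT).1.2 (h X hX)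

theorem Divergent.isoContractContract
    (hω : ∀ Γ Γ' : StrandedGraph, Nonempty (StrandedGraph.Iso Γ Γ') → ω Γ = ω Γ')
    (hcontr : ClosedUnderContraction ω) (hins : ClosedUnderInsertion ω)
    (hT : Γ.Divergent ω T) (hS : Γ.Divergent ω S) (hTS : T ⊆ S) :
    Nonempty (Iso (Γ.contract ω S) ((Γ.contract ω T).contract ω (edgesMod ω T S))) :=
  StrandedGraph.isoContractContract hTS fun X hX hXT =>
    (hT.isSD_edgesMod hω hcontr hins hTS hX hXT).2 (hS X hX)

end StrandedGraph

/-! ### The coproduct as one sum over edge sets -/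

namespace StrandedGraph

variable {Γ Γ' : StrandedGraph} {X S T C : Set Γ.E} {ω : StrandedGraph → ℤ}

open Classical in
variable (Γ) in
/-- The generator that belongs to a 1PI Feynman graph, and `1` for all other graphs. -/
def graphGen : GraphAlgebra := if h : Γ.IsFeynman ∧ Γ.IsOnePI then gen ⟨Γ, h⟩ else 1

theorem graphGen_of (h : Γ.IsFeynman ∧ Γ.IsOnePI) : Γ.graphGen = gen ⟨Γ, h⟩ := dif_pos h

/-- This convention turns `Γ/Γ` into `1` and lets fully contracted components drop out of products.
-/
theorem graphGen_of_isEmpty (h : IsEmpty Γ.E) : Γ.graphGen = 1 :=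
  dif_neg fun h' => h'.2.1.elim h.false

theorem Iso.graphGen_eq (f : Iso Γ Γ') : Γ.graphGen = Γ'.graphGen := by
  by_cases h : Γ.IsFeynman ∧ Γ.IsOnePI
  · rw [graphGen_of h, graphGen_of ⟨f.isFeynman h.1, f.isOnePI h.2⟩]
    exact congrArg MvPolynomial.X (Quotient.sound ⟨f⟩)
  · rw [graphGen, dif_neg h, graphGen, dif_neg]
    exact fun h' => h ⟨f.symm.isFeynman h'.1, f.symm.isOnePI h'.2⟩

variable (Γ) in
/-- The subgraph with internal edges `S`, as the product of its connected components. -/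
def subGen (S : Set Γ.E) : GraphAlgebra := ∏ C ∈ Γ.comps S, (Γ.sub C).graphGen

theorem Iso.subGen_image (f : Iso Γ Γ') (S : Set Γ.E) : Γ'.subGen (f.fE '' S) = Γ.subGen S := by
  refine (Finset.prod_nbij (fun C => f.fE '' C) ?_ ?_ ?_ ?_).symm
  · exact fun C hC => mem_comps.2 (f.isComp_map (mem_comps.1 hC))
  · exact f.fE.injective.image_injective.injOn
  · intro C' hC'
    obtain ⟨C, rfl⟩ := f.fE.surjective.image_surjective C'
    exact ⟨C, Finset.mem_coe.2 (mem_comps.2 (f.isComp_iff.1 (mem_comps.1 hC'))), rfl⟩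
  · exact fun C _ => (f.sub C).graphGen_eq

theorem Iso.divergent_image_iff (f : Iso Γ Γ')
    (hω : ∀ Γ Γ' : StrandedGraph, Nonempty (StrandedGraph.Iso Γ Γ') → ω Γ = ω Γ') :
    Γ'.Divergent ω (f.fE '' S) ↔ Γ.Divergent ω S := by
  constructor
  · exact fun h C hC => (f.sub C).symm.isSD hω (h _ (f.isComp_map hC))
  · intro h C' hC'
    obtain ⟨C, rfl⟩ := f.fE.surjective.image_surjective C'
    exact (f.sub C).isSD hω (h C (f.isComp_iff.1 hC'))

theorem comps_empty : Γ.comps ∅ = ∅ :=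
  Finset.eq_empty_of_forall_notMem fun _ h =>
    (mem_comps.1 h).nonempty.elim fun _ he => (mem_comps.1 h).subset he

theorem subGen_empty : Γ.subGen ∅ = 1 := by
  rw [subGen, comps_empty, Finset.prod_empty]

theorem IsComp.comps_self (hX : Γ.IsComp X X) : Γ.comps X = {X} := by
  ext C
  rw [mem_comps, Finset.mem_singleton]
  constructor
  · intro hC
    obtain ⟨e, he⟩ := hC.nonempty
    exact hC.eq_of_mem hX he (hC.subset he)
  · rintro rfl
    exact hX

theorem IsOnePI.subGen_univ (h : Γ.IsOnePI) : Γ.subGen Set.univ = Γ.graphGen := by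
  rw [subGen, h.isComp_univ.comps_self, Finset.prod_singleton]
  exact (isoSubUniv h.touches).graphGen_eq

theorem isDivergentUnion_iff :
    Γ.IsDivergentUnion ω S ↔ S.Nonempty ∧ S ≠ Set.univ ∧ Γ.Divergent ω S := by
  rw [divergent_iff]
  rfl

theorem unionGen_eq (hS : Γ.IsDivergentUnion ω S) : unionGen hS = Γ.subGen S := by
  have : Fintype {x : Quotient (Γ.conn S) // (Γ.comp S x).Nonempty} := Fintype.ofFinite _
  rw [unionGen, finprod_eq_prod_of_fintype, subGen]
  refine Finset.prod_bij (fun x _ => Γ.comp S x.1) ?_ ?_ ?_ ?_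
  · exact fun x _ => mem_comps.2 (isComp_comp x.2)
  · intro x _ y _ h
    obtain ⟨e, he⟩ := x.2
    exact Subtype.ext (he.2.symm.trans (h ▸ he : e ∈ Γ.comp S y.1).2)
  · intro C hC
    obtain ⟨e, he⟩ := (mem_comps.1 hC).nonempty
    have h := (mem_comps.1 hC).eq_comp (touches_tgt he)
    exact ⟨⟨_, h ▸ (mem_comps.1 hC).nonempty⟩, Finset.mem_univ _, h.symm⟩
  · exact fun x _ => (graphGen_of _).symm

variable (Γ ω) in
/-- The divergent sets of edges, and the set of all edges. -/
def divSets : Finset (Set Γ.E) :=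
  (Set.toFinite {S : Set Γ.E | Γ.Divergent ω S ∨ S = Set.univ}).toFinset

@[simp] theorem mem_divSets : S ∈ Γ.divSets ω ↔ Γ.Divergent ω S ∨ S = Set.univ := by
  simp [divSets]

theorem isEmpty_contract_univ : IsEmpty (Γ.contract ω Set.univ).E := ⟨fun e => e.2 trivial⟩

/-- The coproduct of a 1PI graph as one sum. -/
theorem coproductGen_eq (Γ : OnePIGraph) :
    coproductGen ω Γ = ∑ S ∈ Γ.1.divSets ω,
      Γ.1.subGen S ⊗ₜ[ℂ] (Γ.1.contract ω S).graphGen := by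
  classical
  have hfin : Fintype {S : Set Γ.1.E // Γ.1.IsDivergentUnion ω S} := Fintype.ofFinite _
  have : Nonempty Γ.1.E := Γ.2.2.1
  -- The two inserted sets carry the terms `Γ ⊗ 1` and `1 ⊗ Γ`. They are distinct because a 1PI
  -- graph has an edge.
  have hset : Γ.1.divSets ω = insert Set.univ (insert ∅
      (Finset.univ.map (Function.Embedding.subtype fun S => Γ.1.IsDivergentUnion ω S))) := by
    ext S
    simp only [mem_divSets, Finset.mem_insert, Finset.mem_map, Finset.mem_univ, true_and,
      Function.Embedding.subtype_apply, Subtype.exists, exists_prop, exists_eq_right,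
      isDivergentUnion_iff]
    by_cases h1 : S = Set.univ
    · simp [h1]
    by_cases h2 : S = ∅
    · simp [h2, divergent_empty]
    · simp [h1, h2, Set.nonempty_iff_ne_empty]
  rw [hset, Finset.sum_insert, Finset.sum_insert, Finset.sum_map, coproductGen,
    finsum_eq_sum_of_fintype, Γ.2.2.subGen_univ, subGen_empty, graphGen_of Γ.2,
    graphGen_of_isEmpty isEmpty_contract_univ, ← (isoContractEmpty ω Γ.1).graphGen_eq,
    graphGen_of Γ.2, add_assoc]
  · congr 2
    refine Finset.sum_congr rfl fun S _ => ?_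
    rw [unionGen_eq, ← graphGen_of]
    rfl
  · simp only [Finset.mem_map, Finset.mem_univ, true_and, Function.Embedding.subtype_apply,
      Subtype.exists, exists_prop, exists_eq_right, isDivergentUnion_iff]
    exact fun h => Set.not_nonempty_empty h.1
  · simp only [Finset.mem_insert, Finset.mem_map, Finset.mem_univ, true_and,
      Function.Embedding.subtype_apply, Subtype.exists, exists_prop, exists_eq_right,
      isDivergentUnion_iff]
    rintro (h | h)
    · exact Set.empty_ne_univ h.symm
    · exact h.2.1 rfl

/-- The coproduct of a generator depends only on the isomorphism class of the graph. -/
theorem Iso.coproductGen_eq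
    (hω : ∀ Γ Γ' : StrandedGraph, Nonempty (StrandedGraph.Iso Γ Γ') → ω Γ = ω Γ')
    {Γ Γ' : OnePIGraph} (f : Iso Γ.1 Γ'.1) : coproductGen ω Γ = coproductGen ω Γ' := by
  rw [StrandedGraph.coproductGen_eq, StrandedGraph.coproductGen_eq]
  refine Finset.sum_nbij (fun S => f.fE '' S) ?_ ?_ ?_ ?_
  · intro S hS
    rw [mem_divSets] at hS ⊢
    refine hS.imp (f.divergent_image_iff hω).2 ?_
    rintro rfl
    rw [Set.image_univ, f.fE.range_eq_univ]
  · exact f.fE.injective.image_injective.injOn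
  · intro S' hS'
    obtain ⟨S, rfl⟩ := f.fE.surjective.image_surjective S'
    refine ⟨S, ?_, rfl⟩
    rw [Finset.mem_coe, mem_divSets] at hS' ⊢
    refine hS'.imp (f.divergent_image_iff hω).1 fun h => ?_
    rw [← f.fE.range_eq_univ, ← Set.image_univ] at h
    exact f.fE.injective.image_injective h
  · intro S _
    obtain ⟨g⟩ := f.contract S hω
    rw [f.subGen_image, g.graphGen_eq]

/-- The representative chosen in `coproduct` is isomorphic to `Γ`, so invariance of `coproductGen`
removes the choice. -/
theorem coproduct_gen
    (hω : ∀ Γ Γ' : StrandedGraph, Nonempty (StrandedGraph.Iso Γ Γ') → ω Γ = ω Γ')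
    (Γ : OnePIGraph) : coproduct ω (gen Γ) = coproductGen ω Γ := by
  rw [coproduct, gen, MvPolynomial.aeval_X]
  obtain ⟨f⟩ : (Quotient.mk onePISetoid Γ).out ≈ Γ := Quotient.mk_out Γ
  exact f.coproductGen_eq hω

theorem coproduct_graphGen
    (hω : ∀ Γ Γ' : StrandedGraph, Nonempty (StrandedGraph.Iso Γ Γ') → ω Γ = ω Γ')
    (h : Γ.IsFeynman ∧ Γ.IsOnePI) :
    coproduct ω Γ.graphGen = ∑ S ∈ Γ.divSets ω, Γ.subGen S ⊗ₜ[ℂ] (Γ.contract ω S).graphGen := by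
  rw [graphGen_of h, coproduct_gen hω, coproductGen_eq]

end StrandedGraph

/-! ### Both iterated coproducts as sums over nested pairs -/

theorem prod_tmul_prod {ι R A B : Type*} [CommSemiring R] [CommSemiring A] [Algebra R A]
    [CommSemiring B] [Algebra R B] (s : Finset ι) (f : ι → A) (g : ι → B) :
    ∏ i ∈ s, f i ⊗ₜ[R] g i = (∏ i ∈ s, f i) ⊗ₜ[R] ∏ i ∈ s, g i := by
  classical
  induction s using Finset.induction_on with
  | empty => simp [Algebra.TensorProduct.one_def]
  | insert i s hi ih => simp [Finset.prod_insert hi, ih]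

namespace StrandedGraph

variable {Γ Γ' : StrandedGraph} {X S T C : Set Γ.E} {ω : StrandedGraph → ℤ}

/-- The components of a subset `T` of `S`, sorted by the components of `S`. -/
theorem prod_comps_inter {M : Type*} [CommMonoid M] (hTS : T ⊆ S) (F : Set Γ.E → M) :
    ∏ X ∈ Γ.comps S, ∏ C ∈ Γ.comps (T ∩ X), F C = ∏ C ∈ Γ.comps T, F C := by
  classical
  rw [← Finset.prod_biUnion]
  · refine Finset.prod_congr (Finset.ext fun C => ?_) fun _ _ => rfl
    simp only [Finset.mem_biUnion, mem_comps]
    constructor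
    · rintro ⟨X, hX, hC⟩
      exact ((isComp_inter_iff (hX.closed.mono hTS)).1 hC).1
    · intro hC
      obtain ⟨e, he⟩ := hC.nonempty
      obtain ⟨X, hX, heX⟩ := exists_isComp (hTS (hC.subset he))
      exact ⟨X, hX, (isComp_inter_iff (hX.closed.mono hTS)).2
        ⟨hC, hC.subset_of_mem hX hTS he heX⟩⟩
  · intro X hX X' hX' hne
    refine Finset.disjoint_left.2 fun C hC hC' => hne ?_
    rw [mem_comps] at hC hC'
    obtain ⟨e, he⟩ := hC.nonempty
    exact (mem_comps.1 hX).eq_of_mem (mem_comps.1 hX') (hC.subset he).2 (hC'.subset he).2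

theorem subGen_edgesIn (hT : T ⊆ X) : (Γ.sub X).subGen (edgesIn X T) = Γ.subGen T := by
  have hTX : T ∩ X = T := Set.inter_eq_left.2 hT
  refine (Finset.prod_bij (fun C _ => edgesIn X C) ?_ ?_ ?_ ?_).symm
  · intro C hC
    rw [mem_comps] at hC ⊢
    rwa [isComp_edgesIn_iff (hC.subset.trans hT), hTX]
  · intro C hC D hD h
    rw [mem_comps] at hC hD
    have h1 := edgesIn_eq_iff.1 h
    rwa [Set.inter_eq_left.2 (hC.subset.trans hT), Set.inter_eq_left.2 (hD.subset.trans hT)] at h1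
  · intro C' hC'
    obtain ⟨C, hCX, rfl⟩ := exists_edgesIn C'
    rw [mem_comps, isComp_edgesIn_iff hCX, hTX] at hC'
    exact ⟨C, mem_comps.2 hC', rfl⟩
  · intro C hC
    rw [mem_comps] at hC
    exact ((isoSubSub C X).trans
      (isoSubOfEq (Set.inter_eq_left.2 (hC.subset.trans hT)))).symm.graphGen_eq

theorem divergent_edgesIn_iff
    (hω : ∀ Γ Γ' : StrandedGraph, Nonempty (StrandedGraph.Iso Γ Γ') → ω Γ = ω Γ')
    (hT : T ⊆ X) : (Γ.sub X).Divergent ω (edgesIn X T) ↔ Γ.Divergent ω T := by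
  have hTX : T ∩ X = T := Set.inter_eq_left.2 hT
  have hiso : ∀ C, C ⊆ X → (((Γ.sub X).sub (edgesIn X C)).IsSD ω ↔ (Γ.sub C).IsSD ω) := by
    intro C hC
    have f := (isoSubSub C X).trans (isoSubOfEq (Set.inter_eq_left.2 hC))
    exact ⟨f.isSD hω, f.symm.isSD hω⟩
  constructor
  · intro h C hC
    have hCX := hC.subset.trans hT
    exact (hiso C hCX).1 (h _ ((isComp_edgesIn_iff hCX).2 (hTX.symm ▸ hC)))
  · intro h C' hC'
    obtain ⟨C, hCX, rfl⟩ := exists_edgesIn C'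
    rw [isComp_edgesIn_iff hCX, hTX] at hC'
    exact (hiso C hCX).2 (h C hC')

variable (Γ ω) in
/-- The divergent sets of edges that are contained in `X`. -/
def divSubsets (X : Set Γ.E) : Finset (Set Γ.E) :=
  (Set.toFinite {T | Γ.Divergent ω T ∧ T ⊆ X}).toFinset

@[simp] theorem mem_divSubsets : T ∈ Γ.divSubsets ω X ↔ Γ.Divergent ω T ∧ T ⊆ X := by
  simp [divSubsets]

/-- The coproduct of a superficially divergent subgraph. -/
theorem coproduct_graphGen_sub
    (hω : ∀ Γ Γ' : StrandedGraph, Nonempty (StrandedGraph.Iso Γ Γ') → ω Γ = ω Γ')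
    (hX : Γ.IsComp X X) (hsd : (Γ.sub X).IsSD ω) :
    coproduct ω (Γ.sub X).graphGen = ∑ T ∈ Γ.divSubsets ω X,
      Γ.subGen T ⊗ₜ[ℂ] ((Γ.sub X).contract ω (edgesIn X T)).graphGen := by
  rw [coproduct_graphGen hω ⟨hsd.1, hsd.2.1⟩]
  refine (Finset.sum_bij (fun T _ => edgesIn X T) ?_ ?_ ?_ ?_).symm
  · intro T hT
    rw [mem_divSubsets] at hT
    exact mem_divSets.2 (Or.inl ((divergent_edgesIn_iff hω hT.2).2 hT.1))
  · intro T hT T' hT' h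
    rw [mem_divSubsets] at hT hT'
    have h1 := edgesIn_eq_iff.1 h
    rwa [Set.inter_eq_left.2 hT.2, Set.inter_eq_left.2 hT'.2] at h1
  · intro T' hT'
    obtain ⟨T, hTX, rfl⟩ := exists_edgesIn T'
    refine ⟨T, mem_divSubsets.2 ⟨?_, hTX⟩, rfl⟩
    rcases mem_divSets.1 hT' with h | h
    · exact (divergent_edgesIn_iff hω hTX).1 h
    -- The full edge set is no exception here: it corresponds to `X`, which is divergent by `hsd`.
    · rw [hTX.antisymm (edgesIn_eq_univ_iff.1 h)]
      intro C hC
      rw [← mem_comps, hX.comps_self, Finset.mem_singleton] at hC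
      exact hC ▸ hsd
  · intro T hT
    rw [subGen_edgesIn (mem_divSubsets.1 hT).2]

/-- Distinct components are disjoint, so a choice of one subset per component is recovered from its
union. -/
theorem iUnion_inter_of_isComp {p : ∀ X ∈ Γ.comps S, Set Γ.E} (hp : ∀ X hX, p X hX ⊆ X)
    (hX : X ∈ Γ.comps S) : (⋃ (Y) (hY : Y ∈ Γ.comps S), p Y hY) ∩ X = p X hX := by
  ext e
  simp only [Set.mem_inter_iff, Set.mem_iUnion]
  constructor
  · rintro ⟨⟨Y, hY, he⟩, heX⟩
    obtain rfl := (mem_comps.1 hY).eq_of_mem (mem_comps.1 hX) (hp Y hY he) heX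
    exact he
  · exact fun he => ⟨⟨X, hX, he⟩, hp X hX he⟩

variable (Γ ω) in
/-- The subgraph with internal edges `S`, with the subgraph with internal edges `T` contracted, as
the product of its connected components. -/
def subContractGen (S T : Set Γ.E) : GraphAlgebra :=
  ∏ X ∈ Γ.comps S, ((Γ.sub X).contract ω (edgesIn X T)).graphGen

/-- The coproduct of a divergent subgraph. -/
theorem Divergent.coproduct_subGen
    (hω : ∀ Γ Γ' : StrandedGraph, Nonempty (StrandedGraph.Iso Γ Γ') → ω Γ = ω Γ')
    (hS : Γ.Divergent ω S) :
    coproduct ω (Γ.subGen S) = ∑ T ∈ Γ.divSubsets ω S,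
      Γ.subGen T ⊗ₜ[ℂ] Γ.subContractGen ω S T := by
  classical
  rw [subGen, map_prod, Finset.prod_congr rfl fun X hX => coproduct_graphGen_sub hω
    (mem_comps.1 hX).self_isComp (hS X (mem_comps.1 hX)), Finset.prod_sum]
  -- Expanding the product of sums gives families of divergent subsets, one per component of `S`;
  -- such families correspond to divergent `T ⊆ S` by intersection and union.
  refine (Finset.sum_bij' (fun T _ X _ => T ∩ X)
    (fun p _ => ⋃ (X) (hX : X ∈ Γ.comps S), p X hX) ?_ ?_ ?_ ?_ ?_).symm
  · intro T hT
    rw [mem_divSubsets] at hT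
    refine Finset.mem_pi.2 fun X hX => mem_divSubsets.2 ⟨?_, Set.inter_subset_right⟩
    exact hT.1.inter ((mem_comps.1 hX).closed.mono hT.2)
  · intro p hp
    have hp' := fun X hX => mem_divSubsets.1 (Finset.mem_pi.1 hp X hX)
    have hsub : (⋃ (X) (hX : X ∈ Γ.comps S), p X hX) ⊆ S :=
      Set.iUnion₂_subset fun X hX => (hp' X hX).2.trans (mem_comps.1 hX).subset
    refine mem_divSubsets.2 ⟨fun C hC => ?_, hsub⟩
    obtain ⟨e, he⟩ := hC.nonempty
    obtain ⟨X, hX, heX⟩ := Set.mem_iUnion₂.1 (hC.subset he)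
    have hXc := mem_comps.1 hX
    refine (hp' X hX).1 C ?_
    rw [← iUnion_inter_of_isComp (fun X hX => (hp' X hX).2) hX,
      isComp_inter_iff (hXc.closed.mono hsub)]
    exact ⟨hC, hC.subset_of_mem hXc hsub he ((hp' X hX).2 heX)⟩
  · intro T hT
    have hTS := (mem_divSubsets.1 hT).2
    ext e
    simp only [Set.mem_iUnion, Set.mem_inter_iff, exists_prop, mem_comps]
    constructor
    · rintro ⟨X, _, he, _⟩
      exact he
    · intro he
      obtain ⟨X, hX, heX⟩ := exists_isComp (hTS he)
      exact ⟨X, hX, he, heX⟩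
  · intro p hp
    have hp' := fun X hX => mem_divSubsets.1 (Finset.mem_pi.1 hp X hX)
    funext X hX
    exact iUnion_inter_of_isComp (fun X hX => (hp' X hX).2) hX
  · intro T hT
    rw [Finset.prod_attach (Γ.comps S) fun X => Γ.subGen (T ∩ X) ⊗ₜ[ℂ]
      ((Γ.sub X).contract ω (edgesIn X (T ∩ X))).graphGen, prod_tmul_prod]
    simp only [edgesIn_inter]
    exact congrArg (· ⊗ₜ[ℂ] _) (prod_comps_inter (mem_divSubsets.1 hT).2 _).symm

/-- The coproduct of the first factors in the coproduct of a 1PI graph. -/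
theorem IsOnePI.coproduct_subGen
    (hω : ∀ Γ Γ' : StrandedGraph, Nonempty (StrandedGraph.Iso Γ Γ') → ω Γ = ω Γ')
    (hF : Γ.IsFeynman) (h : Γ.IsOnePI) (hS : S ∈ Γ.divSets ω) [DecidablePred (· ⊆ S)] :
    coproduct ω (Γ.subGen S) = ∑ T ∈ (Γ.divSets ω).filter (· ⊆ S),
      Γ.subGen T ⊗ₜ[ℂ] Γ.subContractGen ω S T := by
  -- The full set is separate because `Γ` itself need not be divergent; it is one generator, with
  -- the coproduct formula for 1PI graphs.
  by_cases hS' : S = Set.univ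
  · subst hS'
    rw [Finset.filter_true_of_mem fun T _ => Set.subset_univ T, h.subGen_univ,
      coproduct_graphGen hω ⟨hF, h⟩]
    refine Finset.sum_congr rfl fun T _ => ?_
    rw [subContractGen, h.isComp_univ.comps_self, Finset.prod_singleton]
    obtain ⟨g⟩ := (isoSubUniv h.touches).contract (edgesIn Set.univ T) hω
    rw [g.graphGen_eq]
    congr 1
    refine (isoContractOfEq ω ?_).graphGen_eq
    ext e
    exact ⟨fun he => ⟨⟨e, trivial⟩, he, rfl⟩, fun ⟨e', he', h⟩ => h ▸ he'⟩
  · have hS := (mem_divSets.1 hS).resolve_right hS'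
    rw [hS.coproduct_subGen hω]
    refine Finset.sum_congr (Finset.ext fun T => ?_) fun _ _ => rfl
    rw [mem_divSubsets, Finset.mem_filter, mem_divSets]
    refine and_congr_left fun hTS => (or_iff_left ?_).symm
    rintro rfl
    exact hS' (Set.eq_univ_of_univ_subset hTS)

/-- The components of `S` inside `T` contract to graphs without edges and contribute `1`; the others
are in bijection with the components of `S/T`, with isomorphic graphs. -/
theorem subContractGen_eq
    (hω : ∀ Γ Γ' : StrandedGraph, Nonempty (StrandedGraph.Iso Γ Γ') → ω Γ = ω Γ')
    (hTS : T ⊆ S) :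
    Γ.subContractGen ω S T = (Γ.contract ω T).subGen (edgesMod ω T S) := by
  classical
  have hfil : ∀ X ∈ Γ.comps S, ((Γ.sub X).contract ω (edgesIn X T)).graphGen ≠ 1 → ¬ X ⊆ T :=
    fun X _ h hXT => h (graphGen_of_isEmpty ⟨fun e => e.2 (hXT e.1.2)⟩)
  rw [subContractGen, ← Finset.prod_filter_of_ne hfil, subGen]
  refine Finset.prod_bij (fun X _ => edgesMod ω T X) ?_ ?_ ?_ ?_
  · intro X hX
    rw [Finset.mem_filter, mem_comps] at hX
    exact mem_comps.2 (hX.1.mod hTS hX.2)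
  · intro X hX Y hY h
    rw [Finset.mem_filter, mem_comps] at hX hY
    obtain ⟨e, he, heT⟩ := Set.not_subset.1 hX.2
    exact hX.1.eq_of_mem hY.1 he ((Set.ext_iff.1 h ⟨e, heT⟩).1 he)
  · intro C' hC'
    obtain ⟨X, hX, hXT, rfl⟩ := (isComp_edgesMod_iff hTS).1 (mem_comps.1 hC')
    exact ⟨X, Finset.mem_filter.2 ⟨mem_comps.2 hX, hXT⟩, rfl⟩
  · intro X hX
    rw [Finset.mem_filter, mem_comps] at hX
    obtain ⟨f⟩ := hX.1.isoSubContract hω hTS hX.2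
    exact f.graphGen_eq

theorem Divergent.isFeynman_contract (hF : Γ.IsFeynman) (hT : Γ.Divergent ω T)
    (hne : T ≠ Set.univ) : (Γ.contract ω T).IsFeynman := by
  rcases T.eq_empty_or_nonempty with rfl | h
  · exact (isoContractEmpty ω Γ).isFeynman hF
  · exact hF.contract (isDivergentUnion_iff.2 ⟨h, hne, hT⟩)

/-- The coproduct of the second factors in the coproduct of a 1PI graph. -/
theorem IsOnePI.coproduct_contract
    (hω : ∀ Γ Γ' : StrandedGraph, Nonempty (StrandedGraph.Iso Γ Γ') → ω Γ = ω Γ')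
    (hcontr : ClosedUnderContraction ω) (hins : ClosedUnderInsertion ω)
    (hF : Γ.IsFeynman) (h : Γ.IsOnePI) (hT : T ∈ Γ.divSets ω) [DecidablePred (T ⊆ ·)] :
    coproduct ω (Γ.contract ω T).graphGen = ∑ S ∈ (Γ.divSets ω).filter (T ⊆ ·),
      Γ.subContractGen ω S T ⊗ₜ[ℂ] (Γ.contract ω S).graphGen := by
  have hsum : ∀ S ∈ (Γ.divSets ω).filter (T ⊆ ·),
      Γ.subContractGen ω S T ⊗ₜ[ℂ] (Γ.contract ω S).graphGen =
      (Γ.contract ω T).subGen (edgesMod ω T S) ⊗ₜ[ℂ] (Γ.contract ω S).graphGen :=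
    fun S hS => by rw [subContractGen_eq hω (Finset.mem_filter.1 hS).2]
  rw [Finset.sum_congr rfl hsum]
  -- For the full set `Γ/T` is `1`, and only `S = T` remains in the sum, giving `1 ⊗ 1`.
  by_cases hT' : T = Set.univ
  · subst hT'
    have hfil : (Γ.divSets ω).filter (Set.univ ⊆ ·) = {Set.univ} := by
      ext S
      rw [Finset.mem_filter, Finset.mem_singleton, Set.univ_subset_iff]
      exact ⟨fun h => h.2, fun h => ⟨mem_divSets.2 (Or.inr h), h⟩⟩
    have hempty : edgesMod ω (Set.univ : Set Γ.E) Set.univ = ∅ := by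
      ext e
      exact (e.2 trivial).elim
    rw [hfil, Finset.sum_singleton, hempty, subGen_empty,
      graphGen_of_isEmpty isEmpty_contract_univ, map_one, Algebra.TensorProduct.one_def]
  · have hT := (mem_divSets.1 hT).resolve_right hT'
    rw [coproduct_graphGen hω ⟨hT.isFeynman_contract hF hT', h.contract hT'⟩]
    refine (Finset.sum_bij (fun S _ => edgesMod ω T S) ?_ ?_ ?_ ?_).symm
    · intro S hS
      rw [Finset.mem_filter, mem_divSets] at hS
      rw [mem_divSets, hT.divergent_edgesMod_iff hω hcontr hins hS.2, edgesMod_eq_univ_iff hS.2]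
      exact hS.1
    · intro S hS S' hS' h
      exact edgesMod_injOn (Finset.mem_filter.1 hS).2 (Finset.mem_filter.1 hS').2 h
    · intro S' hS'
      obtain ⟨S, hTS, rfl⟩ := edgesMod_image_union S'
      rw [mem_divSets, hT.divergent_edgesMod_iff hω hcontr hins hTS,
        edgesMod_eq_univ_iff hTS] at hS'
      exact ⟨S, Finset.mem_filter.2 ⟨mem_divSets.2 hS', hTS⟩, rfl⟩
    · intro S hS
      rw [Finset.mem_filter, mem_divSets] at hS
      congr 1
      -- The two-step contraction needs equal degrees, which are available only for divergent `S`.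
      -- For the full set no isomorphism is needed, since both graphs have no edges and count as
      -- `1`.
      by_cases hS' : S = Set.univ
      · subst hS'
        rw [graphGen_of_isEmpty isEmpty_contract_univ, graphGen_of_isEmpty]
        exact ⟨fun e => e.2 trivial⟩
      · obtain ⟨f⟩ := hT.isoContractContract hω hcontr hins (hS.1.resolve_right hS') hS.2
        exact f.graphGen_eq

theorem coassoc_gen
    (hω : ∀ Γ Γ' : StrandedGraph, Nonempty (StrandedGraph.Iso Γ Γ') → ω Γ = ω Γ')
    (hcontr : ClosedUnderContraction ω) (hins : ClosedUnderInsertion ω) (Γ : OnePIGraph) :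
    Algebra.TensorProduct.assoc ℂ ℂ ℂ GraphAlgebra GraphAlgebra GraphAlgebra
        (Algebra.TensorProduct.map (coproduct ω) (AlgHom.id ℂ GraphAlgebra)
          (coproduct ω (gen Γ))) =
      Algebra.TensorProduct.map (AlgHom.id ℂ GraphAlgebra) (coproduct ω)
        (coproduct ω (gen Γ)) := by
  classical
  rw [coproduct_gen hω, coproductGen_eq, map_sum, map_sum, map_sum]
  have hl : ∀ S ∈ Γ.1.divSets ω,
      Algebra.TensorProduct.assoc ℂ ℂ ℂ GraphAlgebra GraphAlgebra GraphAlgebra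
        (Algebra.TensorProduct.map (coproduct ω) (AlgHom.id ℂ GraphAlgebra)
          (Γ.1.subGen S ⊗ₜ[ℂ] (Γ.1.contract ω S).graphGen)) =
      ∑ T ∈ (Γ.1.divSets ω).filter (· ⊆ S), Γ.1.subGen T ⊗ₜ[ℂ]
        (Γ.1.subContractGen ω S T ⊗ₜ[ℂ] (Γ.1.contract ω S).graphGen) := by
    intro S hS
    rw [Algebra.TensorProduct.map_tmul, Γ.2.2.coproduct_subGen hω Γ.2.1 hS,
      TensorProduct.sum_tmul, map_sum]
    rfl
  have hr : ∀ T ∈ Γ.1.divSets ω,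
      Algebra.TensorProduct.map (AlgHom.id ℂ GraphAlgebra) (coproduct ω)
        (Γ.1.subGen T ⊗ₜ[ℂ] (Γ.1.contract ω T).graphGen) =
      ∑ S ∈ (Γ.1.divSets ω).filter (T ⊆ ·), Γ.1.subGen T ⊗ₜ[ℂ]
        (Γ.1.subContractGen ω S T ⊗ₜ[ℂ] (Γ.1.contract ω S).graphGen) := by
    intro T hT
    rw [Algebra.TensorProduct.map_tmul, Γ.2.2.coproduct_contract hω hcontr hins Γ.2.1 hT,
      TensorProduct.tmul_sum]
    rfl
  rw [Finset.sum_congr rfl hl, Finset.sum_congr rfl hr]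
  -- Both sides now have the same summand over pairs `T ⊆ S`, summed in opposite orders.
  refine Finset.sum_comm' fun S T => ?_
  simp only [Finset.mem_filter]
  tauto

end StrandedGraph
end

theorem mainTheorem4 (ω : StrandedGraph → ℤ)
    (hω : ∀ Γ Γ' : StrandedGraph, Nonempty (StrandedGraph.Iso Γ Γ') → ω Γ = ω Γ')
    (hcontr : StrandedGraph.ClosedUnderContraction ω)
    (hins : StrandedGraph.ClosedUnderInsertion ω) :
    (∀ Γ : OnePIGraph, coproduct ω (gen Γ) = coproductGen ω Γ) ∧
    (TensorProduct.assoc ℂ GraphAlgebra GraphAlgebra GraphAlgebra).toLinearMap ∘ₗ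
        (coproduct ω).toLinearMap.rTensor GraphAlgebra ∘ₗ (coproduct ω).toLinearMap =
      (coproduct ω).toLinearMap.lTensor GraphAlgebra ∘ₗ (coproduct ω).toLinearMap := by
  refine ⟨StrandedGraph.coproduct_gen hω, ?_⟩
  -- Both composites are algebra homomorphisms, so equality on the generators suffices.
  have h : ((Algebra.TensorProduct.assoc ℂ ℂ ℂ GraphAlgebra GraphAlgebra GraphAlgebra).toAlgHom.comp
      (Algebra.TensorProduct.map (coproduct ω) (AlgHom.id ℂ GraphAlgebra))).comp (coproduct ω) =
      (Algebra.TensorProduct.map (AlgHom.id ℂ GraphAlgebra) (coproduct ω)).comp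
        (coproduct ω) := by
    refine MvPolynomial.algHom_ext fun x => ?_
    induction x using Quotient.ind with | _ Γ
    exact StrandedGraph.coassoc_gen hω hcontr hins Γ
  exact congrArg AlgHom.toLinearMap h
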